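/- Let $n\ge 1$ and $m\ge 0$ be integers, let $dv$ be Lebesgue measure on $\mathbb{C}^n$, and let $dV_m(z)=\omega_{n,m}|z|^{2m}e^{-|z|^2}\,dv(z)$ with $\omega_{n,m}=\frac{(n-1)!}{\pi^n\,\Gamma(m+n)}$. Let $F^2$ be the space of entire functions $g$ on $\mathbb{C}^n$ with $\|g\|_2^2=\pi^{-n}\int_{\mathbb{C}^n}|g(z)|^2e^{-|z|^2}\,dv(z)<\infty$. Let the Fock–Sobolev space $F^{2,m}$ be the space of entire functions $g$ with $\sum_{|\alpha|\le m}\|\partial^\alpha g\|_2<\infty$, regarded as a closed subspace of $L^2_m=L^2(\mathbb{C}^n,dV_m)$ with the norm of $L^2_m$, and let $P_m$ be the orthogonal projection of $L^2_m$ onto $F^{2,m}$. For a function $f$ on $\mathbb{C}^n$, the Hankel operator $H_f$ is defined by $H_f g=(I-P_m)(fg)\in L^2_m$ for all $g\in F^{2,m}$ with $fg\in L^2_m$, and $H_f$ is called compact on $F^{2,m}$ if it extends to a compact linear operator $F^{2,m}\to L^2_m$. Let $f$ be a polynomial in $z$ and $\overline z$, that is, $f(z)=p(z_1,\dots,z_n,\overline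 z_1,\dots,\overline z_n)$ with a complex polynomial $p$ in $2n$ variables. Then $H_f$ is compact on $F^{2,m}$ if and only if $f$ is holomorphic on $\mathbb{C}^n$. -/

import Mathlib

open MeasureTheory Filter Topology
open scoped ENNReal

namespace FockSobolev

theorem norm_fderiv_apply_le_of_sphere {E : Type*} [NormedAddCommGroup E] [NormedSpace ℂ E]
    {f : E → ℂ} (hf : Differentiable ℂ f) {z : E} {M : ℝ} (hM : 0 ≤ M)
    (h : ∀ w, ‖w - z‖ ≤ 1 → ‖f w‖ ≤ M) : ‖fderiv ℂ f z‖ ≤ M := by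
  refine ContinuousLinearMap.opNorm_le_bound _ hM fun v => ?_
  rcases eq_or_ne v 0 with rfl | hv
  · simp
  have hv' : 0 < ‖v‖ := norm_pos_iff.2 hv
  have hd : HasDerivAt (fun t : ℂ => f (z + t • v)) (fderiv ℂ f z v) 0 := by
    have h1 : HasDerivAt (fun t : ℂ => z + t • v) v 0 := by
      simpa using ((hasDerivAt_id (0 : ℂ)).smul_const v).const_add z
    have h2 : HasFDerivAt f (fderiv ℂ f z) (z + (0 : ℂ) • v) := by
      simpa using (hf z).hasFDerivAt
    exact h2.comp_hasDerivAt (0 : ℂ) h1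
  have hdiff : Differentiable ℂ (fun t : ℂ => f (z + t • v)) := by fun_prop
  have := Complex.norm_deriv_le_of_forall_mem_sphere_norm_le (c := (0 : ℂ)) (R := ‖v‖⁻¹) (C := M)
    (by positivity) hdiff.diffContOnCl (fun t ht => h _ (by
      have : ‖t‖ = ‖v‖⁻¹ := by simpa using ht
      simp [norm_smul, this, hv'.ne']))
  rw [hd.deriv] at this
  simpa [div_eq_mul_inv] using this

theorem differentiable_of_tendsto_entire {E : Type*} [NormedAddCommGroup E] [NormedSpace ℂ E]
    {F : ℕ → E → ℂ} {f : E → ℂ} (hF : ∀ k, Differentiable ℂ (F k))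
    (h : ∀ R : ℝ, TendstoUniformlyOn F f atTop (Metric.ball 0 R)) : Differentiable ℂ f := by
  have hC : ∀ R : ℝ, UniformCauchySeqOn (fun k => fderiv ℂ (F k)) atTop (Metric.ball 0 R) := by
    intro R
    rw [Metric.uniformCauchySeqOn_iff]
    intro ε hε
    obtain ⟨N, hN⟩ := Metric.uniformCauchySeqOn_iff.1 (h (R + 2)).uniformCauchySeqOn (ε / 2)
      (by positivity)
    refine ⟨N, fun k hk l hl z hz => ?_⟩
    have hz' : ‖z‖ < R := by simpa using hz
    have : fderiv ℂ (F k) z - fderiv ℂ (F l) z = fderiv ℂ (F k - F l) z :=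
      (fderiv_sub (hF k z) (hF l z)).symm
    rw [dist_eq_norm, this]
    refine (norm_fderiv_apply_le_of_sphere ((hF k).sub (hF l)) (M := ε / 2) (by positivity)
      fun w hw => ?_).trans_lt (by linarith)
    have := hN k hk l hl w (by
      have : ‖w‖ ≤ ‖w - z‖ + ‖z‖ := by simpa using norm_add_le (w - z) z
      simp; linarith)
    rw [dist_eq_norm] at this
    exact this.le
  have hlim : ∀ z, ∃ L, Tendsto (fun k => fderiv ℂ (F k) z) atTop (𝓝 L) := fun z =>
    cauchySeq_tendsto_of_complete ((hC (‖z‖ + 1)).cauchySeq (x := z) (by simp))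
  choose g' hg' using hlim
  intro z
  have h1 : TendstoUniformlyOn (fun k => fderiv ℂ (F k)) g' atTop (Metric.ball 0 (‖z‖ + 1)) :=
    (hC _).tendstoUniformlyOn_of_tendsto fun w _ => hg' w
  exact (hasFDerivAt_of_tendstoUniformlyOn Metric.isOpen_ball h1
    (fun k w _ => (hF k w).hasFDerivAt) (fun w hw => (h _).tendsto_at hw)
    (by simp : z ∈ Metric.ball (0 : E) (‖z‖ + 1))).differentiableAt

theorem differentiable_fderiv_apply {E : Type*} [NormedAddCommGroup E] [NormedSpace ℂ E]
    [ProperSpace E]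
    {f : E → ℂ} (hf : Differentiable ℂ f) (v : E) : Differentiable ℂ (fun z => fderiv ℂ f z v) := by
  set h : ℕ → ℂ := fun k => ((1 / ((k : ℝ) + 1) : ℝ) : ℂ) with hh
  have hh0 : ∀ k, h k ≠ 0 := fun k => by
    have : (0:ℝ) < 1 / ((k : ℝ) + 1) := by positivity
    simp only [hh]; exact_mod_cast this.ne'
  have hnorm : ∀ k, ‖h k‖ = 1 / ((k : ℝ) + 1) := fun k => by
    have : (0:ℝ) < 1 / ((k : ℝ) + 1) := by positivity
    simp only [hh, Complex.norm_real, Real.norm_eq_abs, abs_of_pos this]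
  refine differentiable_of_tendsto_entire
    (F := fun k z => (h k)⁻¹ * (f (z + h k • v) - f z)) (fun k => by fun_prop) fun R => ?_
  obtain ⟨M, hM⟩ := (isCompact_closedBall (0 : E) (R + ‖v‖)).exists_bound_of_continuousOn
    hf.continuous.continuousOn
  rw [Metric.tendstoUniformlyOn_iff]
  intro ε hε
  have hlim : Tendsto (fun k : ℕ => (4 * |M| + 1) * (1 / ((k : ℝ) + 1))) atTop (𝓝 0) := by
    simpa using tendsto_one_div_add_atTop_nhds_zero_nat.const_mul (4 * |M| + 1)
  filter_upwards [hlim.eventually (gt_mem_nhds hε), eventually_gt_atTop 0] with k hk hk0 z hz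
  have hz' : ‖z‖ < R := by simpa using hz
  set φ : ℂ → ℂ := fun t => f (z + t • v) with hφ
  have hφd : Differentiable ℂ φ := by fun_prop
  have hderiv : deriv φ 0 = fderiv ℂ f z v := by
    have h1 : HasDerivAt (fun t : ℂ => z + t • v) v 0 := by
      simpa using ((hasDerivAt_id (0 : ℂ)).smul_const v).const_add z
    have h2 : HasFDerivAt f (fderiv ℂ f z) (z + (0 : ℂ) • v) := by
      simpa using (hf z).hasFDerivAt
    exact (h2.comp_hasDerivAt (0 : ℂ) h1).deriv
  have hb : ∀ t : ℂ, ‖t‖ ≤ 1 → ‖φ t‖ ≤ |M| := fun t ht => by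
    refine (hM _ ?_).trans (le_abs_self M)
    have := norm_add_le z (t • v)
    rw [norm_smul] at this
    have h3 : ‖t‖ * ‖v‖ ≤ ‖v‖ := mul_le_of_le_one_left (norm_nonneg _) ht
    simp; linarith
  have hsd : Differentiable ℂ (dslope φ 0) := by
    rw [← differentiableOn_univ]
    exact (Complex.differentiableOn_dslope univ_mem).2 hφd.differentiableOn
  have hs : ∀ t : ℂ, ‖t‖ ≤ 1 → ‖dslope φ 0 t‖ ≤ 2 * |M| := by
    intro t ht
    refine Complex.norm_le_of_forall_mem_frontier_norm_le (U := Metric.ball (0:ℂ) 1)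
      Metric.isBounded_ball hsd.diffContOnCl ?_ ?_
    · intro w hw
      rw [frontier_ball _ one_ne_zero] at hw
      have hw1 : ‖w‖ = 1 := by simpa using hw
      have hw0 : w ≠ 0 := fun h => by simp [h] at hw1
      rw [dslope_of_ne _ hw0, slope_def_field, norm_div]
      simp only [sub_zero, hw1, div_one]
      refine (norm_sub_le _ _).trans ?_
      have := hb w hw1.le
      have := hb 0 (by simp)
      linarith
    · rw [closure_ball _ one_ne_zero]; simpa using ht
  have key := Complex.dist_le_div_mul_dist_of_mapsTo_ball (f := dslope φ 0) (c := 0) (z := h k)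
    (R₁ := 1) (R₂ := 4 * |M| + 1) hsd.differentiableOn (fun t ht => by
      have ht' : ‖t‖ < 1 := by simpa using ht
      rw [Metric.mem_closedBall, dist_eq_norm]
      have := norm_sub_le (dslope φ 0 t) (dslope φ 0 0)
      have := hs t ht'.le
      have := hs 0 (by simp)
      linarith) (by
      rw [Metric.mem_ball, dist_zero_right, hnorm, div_lt_one (by positivity)]
      have : (0:ℝ) < k := by exact_mod_cast hk0
      linarith)
  rw [dslope_same, hderiv, dslope_of_ne _ (hh0 k), slope_def_field, dist_zero_right, hnorm] at key
  rw [dist_comm]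
  refine lt_of_le_of_lt ?_ hk
  simpa [hφ, div_eq_inv_mul] using key

theorem exists_circle_measure : ∃ P : Measure ℂ, IsProbabilityMeasure P ∧ (∀ᵐ t ∂P, ‖t‖ = 1) ∧
    ∀ g : ℂ → ℂ, Differentiable ℂ g → ‖g 0‖ₑ ^ 2 ≤ ∫⁻ t, ‖g t‖ₑ ^ 2 ∂P := by
  set Q : Measure ℝ := (ENNReal.ofReal (2 * Real.pi))⁻¹ • volume.restrict (Set.Ioc 0 (2 * Real.pi))
    with hQ
  have hpi : (0 : ℝ) < 2 * Real.pi := by positivity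
  have hQp : IsProbabilityMeasure Q := ⟨by
    simp only [hQ, Measure.smul_apply, Measure.restrict_apply_univ, Real.volume_Ioc, sub_zero,
      smul_eq_mul]
    exact ENNReal.inv_mul_cancel (by simpa using hpi) ENNReal.ofReal_ne_top⟩
  have hm : Measurable (circleMap 0 1) := (continuous_circleMap 0 1).measurable
  refine ⟨Q.map (circleMap 0 1), Measure.isProbabilityMeasure_map hm.aemeasurable, ?_, ?_⟩
  · rw [ae_map_iff hm.aemeasurable (measurableSet_eq_fun measurable_norm measurable_const)]
    exact Eventually.of_forall fun θ => by simp
  · intro g hg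
    rw [lintegral_map (by have := hg.continuous.measurable; fun_prop) hm]
    have h1 := DiffContOnCl.circleAverage (f := fun t => g t ^ 2) (c := 0) (R := 1)
      (by fun_prop : Differentiable ℂ fun t => g t ^ 2).diffContOnCl
    rw [Real.circleAverage_def, intervalIntegral.integral_of_le hpi.le] at h1
    calc ‖g 0‖ₑ ^ 2 = ‖g 0 ^ 2‖ₑ := by rw [enorm_pow]
      _ ≤ (ENNReal.ofReal (2 * Real.pi))⁻¹ *
          ∫⁻ θ in Set.Ioc 0 (2 * Real.pi), ‖g (circleMap 0 1 θ) ^ 2‖ₑ := by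
        rw [← h1, enorm_smul]
        gcongr
        · rw [← ENNReal.ofReal_inv_of_pos hpi, Real.enorm_of_nonneg (by positivity)]
        · exact enorm_integral_le_lintegral_enorm _
      _ = _ := by simp [hQ, lintegral_smul_measure, enorm_pow]

/-- `ℂⁿ` with the Euclidean norm; `volume` on it is Lebesgue measure on `ℂⁿ = ℝ²ⁿ`. -/
abbrev CSpace (n : ℕ) : Type := EuclideanSpace ℂ (Fin n)

/-- The Gaussian measure `π⁻ⁿ e^{-|z|²} dv(z)` of the Fock space `F²`. -/
noncomputable def fockMeasure (n : ℕ) : Measure (CSpace n) :=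
  volume.withDensity fun z => ENNReal.ofReal (1 / Real.pi ^ n * Real.exp (-‖z‖ ^ 2))

/-- The normalizing constant `ω_{n,m} = (n-1)! / (πⁿ Γ(m+n))` (for `n ≥ 1`). -/
noncomputable def omega (n m : ℕ) : ℝ :=
  (Nat.factorial (n - 1) : ℝ) / (Real.pi ^ n * Real.Gamma (m + n))

/-- The measure `dV_m(z) = ω_{n,m} |z|^{2m} e^{-|z|²} dv(z)`. -/
noncomputable def fockSobolevMeasure (n m : ℕ) : Measure (CSpace n) :=
  volume.withDensity fun z =>
    ENNReal.ofReal (omega n m * ‖z‖ ^ (2 * m) * Real.exp (-‖z‖ ^ 2))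

/-- The complex partial derivative `∂f/∂z_j`. -/
noncomputable def partialD {n : ℕ} (j : Fin n) (f : CSpace n → ℂ) : CSpace n → ℂ :=
  fun z => fderiv ℂ f z (EuclideanSpace.single j 1)

/-- `∂^α = ∂₁^{α₁} ⋯ ∂ₙ^{αₙ}`. -/
noncomputable def multiD {n : ℕ} (α : Fin n → ℕ) (f : CSpace n → ℂ) : CSpace n → ℂ :=
  (List.finRange n).foldr (fun j g => (partialD j)^[α j] g) f

/-- `f` is an entire function on `ℂⁿ` with `∂^α f ∈ F²` for all `|α| ≤ m`, that is,
`∑_{|α| ≤ m} ‖∂^α f‖₂ < ∞`. -/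
structure IsFockSobolev (n m : ℕ) (f : CSpace n → ℂ) : Prop where
  entire : Differentiable ℂ f
  memLp : ∀ α : Fin n → ℕ, ∑ j, α j ≤ m → MemLp (multiD α f) 2 (fockMeasure n)

theorem omega_pos (n m : ℕ) [NeZero n] : 0 < omega n m := by
  have : (0 : ℝ) < n := by exact_mod_cast Nat.pos_of_ne_zero (NeZero.ne n)
  have h1 : 0 < Real.Gamma (m + n) := Real.Gamma_pos_of_pos (by positivity)
  have h2 : (0 : ℝ) < Nat.factorial (n - 1) := by exact_mod_cast Nat.factorial_pos _
  unfold omega; positivity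

/-- Auxiliary (used only to prove closedness): `f` is entire and
`∫ (1+|z|²)^k |f|² e^{-|z|²} dv < ∞`. -/
def WInt {n : ℕ} (k : ℕ) (f : CSpace n → ℂ) : Prop :=
  Differentiable ℂ f ∧
    ∫⁻ z, ENNReal.ofReal ((1 + ‖z‖ ^ 2) ^ k * Real.exp (-‖z‖ ^ 2) * ‖f z‖ ^ 2) < ⊤

theorem WInt.mono {n k l : ℕ} (hkl : k ≤ l) {f : CSpace n → ℂ} (h : WInt l f) : WInt k f := by
  refine ⟨h.1, lt_of_le_of_lt (lintegral_mono fun z => ENNReal.ofReal_le_ofReal ?_) h.2⟩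
  gcongr
  nlinarith [sq_nonneg ‖z‖]

theorem circle_pointwise {n : ℕ} (k : ℕ) {f : CSpace n → ℂ} {v : CSpace n} (hv : ‖v‖ = 1)
    (z : CSpace n) {t : ℂ} (ht : ‖t‖ = 1) :
    (1 + ‖z‖ ^ 2) ^ k * Real.exp (-‖z‖ ^ 2) *
      ‖t⁻¹ * (f (z + t • v) * Complex.exp (-(t * inner ℂ z v)) - f z) + inner ℂ z v * f z‖ ^ 2 ≤
    2 * Real.exp 1 * 3 ^ k * ((1 + ‖z + t • v‖ ^ 2) ^ k * Real.exp (-‖z + t • v‖ ^ 2) *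
        ‖f (z + t • v)‖ ^ 2) +
      4 * ((1 + ‖z‖ ^ 2) ^ (k + 1) * Real.exp (-‖z‖ ^ 2) * ‖f z‖ ^ 2) := by
  set w := z + t • v with hw
  set c : ℂ := inner ℂ z v with hc
  have hcn : ‖c‖ ≤ ‖z‖ := by simpa [hv] using norm_inner_le_norm (𝕜 := ℂ) z v
  have hwsq : ‖w‖ ^ 2 = ‖z‖ ^ 2 + 2 * (t * c).re + 1 := by
    rw [hw, @norm_add_sq ℂ, inner_smul_right, norm_smul, ht, hv]; simp [hc]
  have hzw : 1 + ‖z‖ ^ 2 ≤ 3 * (1 + ‖w‖ ^ 2) := by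
    have h1 : ‖z‖ ≤ ‖w‖ + 1 := by
      have := norm_sub_le w (t • v)
      rw [norm_smul, ht, hv] at this
      simpa [hw] using this
    nlinarith [norm_nonneg z, norm_nonneg w, sq_nonneg (‖w‖ - 1)]
  set a : ℝ := ‖f w‖ * Real.exp (-(t * c).re) with ha
  have ha2 : Real.exp (-‖z‖ ^ 2) * a ^ 2 = Real.exp 1 * (Real.exp (-‖w‖ ^ 2) * ‖f w‖ ^ 2) := by
    have : Real.exp (-‖z‖ ^ 2) * Real.exp (-(t * c).re) ^ 2 = Real.exp 1 * Real.exp (-‖w‖ ^ 2) := by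
      rw [← Real.exp_nat_mul, ← Real.exp_add, ← Real.exp_add, hwsq]; congr 1; push_cast; ring
    rw [ha, mul_pow]; linear_combination ‖f w‖ ^ 2 * this
  have hn : ‖t⁻¹ * (f w * Complex.exp (-(t * c)) - f z) + c * f z‖ ≤
      a + (1 + ‖z‖) * ‖f z‖ := by
    have h1 : ‖f w * Complex.exp (-(t * c))‖ = a := by
      rw [norm_mul, Complex.norm_exp]; simp [ha]
    calc _ ≤ ‖t⁻¹ * (f w * Complex.exp (-(t * c)) - f z)‖ + ‖c * f z‖ := norm_add_le _ _
      _ ≤ (a + ‖f z‖) + ‖z‖ * ‖f z‖ := by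
        rw [norm_mul, norm_inv, ht, inv_one, one_mul, norm_mul, ← h1]
        gcongr
        exact norm_sub_le _ _
      _ = _ := by ring
  have hsq : ‖t⁻¹ * (f w * Complex.exp (-(t * c)) - f z) + c * f z‖ ^ 2 ≤
      2 * a ^ 2 + 4 * ((1 + ‖z‖ ^ 2) * ‖f z‖ ^ 2) := by
    have h0 := pow_le_pow_left₀ (norm_nonneg _) hn 2
    have h1 : (1 + ‖z‖) ^ 2 * ‖f z‖ ^ 2 ≤ 2 * (1 + ‖z‖ ^ 2) * ‖f z‖ ^ 2 := by
      gcongr; nlinarith [sq_nonneg (‖z‖ - 1)]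
    nlinarith [sq_nonneg (a - (1 + ‖z‖) * ‖f z‖)]
  calc _ ≤ (1 + ‖z‖ ^ 2) ^ k * Real.exp (-‖z‖ ^ 2) *
        (2 * a ^ 2 + 4 * ((1 + ‖z‖ ^ 2) * ‖f z‖ ^ 2)) := by gcongr
    _ = 2 * Real.exp 1 * ((1 + ‖z‖ ^ 2) ^ k * (Real.exp (-‖w‖ ^ 2) * ‖f w‖ ^ 2)) +
      4 * ((1 + ‖z‖ ^ 2) ^ (k + 1) * Real.exp (-‖z‖ ^ 2) * ‖f z‖ ^ 2) := by
        clear_value a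
        generalize Real.exp (-‖z‖ ^ 2) = x at ha2 ⊢
        rw [pow_succ]; linear_combination 2 * (1 + ‖z‖ ^ 2) ^ k * ha2
    _ ≤ 2 * Real.exp 1 * ((3 * (1 + ‖w‖ ^ 2)) ^ k * (Real.exp (-‖w‖ ^ 2) * ‖f w‖ ^ 2)) +
      4 * ((1 + ‖z‖ ^ 2) ^ (k + 1) * Real.exp (-‖z‖ ^ 2) * ‖f z‖ ^ 2) := by gcongr
    _ = _ := by rw [mul_pow]; ring

theorem WInt.partial_mem {n k : ℕ} (j : Fin n) {f : CSpace n → ℂ} (h : WInt (k + 1) f) :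
    WInt k (partialD j f) := by
  refine ⟨differentiable_fderiv_apply h.1 _, ?_⟩
  obtain ⟨P, hP, hP1, hPm⟩ := exists_circle_measure
  have hf := h.1
  have hfm : Measurable f := hf.continuous.measurable
  set v : CSpace n := EuclideanSpace.single j 1 with hv
  have hv1 : ‖v‖ = 1 := by simp [hv]
  set I : ℕ → CSpace n → ℝ := fun k z => (1 + ‖z‖ ^ 2) ^ k * Real.exp (-‖z‖ ^ 2) * ‖f z‖ ^ 2
    with hI
  have hIm : ∀ k, Measurable (I k) := fun k => by simp only [hI]; fun_prop
  have hpt : ∀ z, ENNReal.ofReal ((1 + ‖z‖ ^ 2) ^ k * Real.exp (-‖z‖ ^ 2) *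
        ‖partialD j f z‖ ^ 2) ≤
      (∫⁻ t, ENNReal.ofReal (2 * Real.exp 1 * 3 ^ k) * ENNReal.ofReal (I k (z + t • v)) ∂P) +
        4 * ENNReal.ofReal (I (k + 1) z) := by
    intro z
    set g : ℂ → ℂ := fun t => f (z + t • v) * Complex.exp (-(t * inner ℂ z v)) with hg
    have hgd : Differentiable ℂ g := by fun_prop
    have hg0 : g 0 = f z := by simp [hg]
    have hderiv : deriv g 0 = fderiv ℂ f z v - inner ℂ z v * f z := by
      have h1 : HasDerivAt (fun t : ℂ => z + t • v) v 0 := by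
        simpa using ((hasDerivAt_id (0 : ℂ)).smul_const v).const_add z
      have h2 : HasFDerivAt f (fderiv ℂ f z) (z + (0 : ℂ) • v) := by
        simpa using (hf z).hasFDerivAt
      have h3 : HasDerivAt (fun t : ℂ => Complex.exp (-(t * inner ℂ z v))) (-inner ℂ z v) 0 := by
        simpa using (((hasDerivAt_id (0 : ℂ)).mul_const (inner ℂ z v)).neg).cexp
      have h4 := ((h2.comp_hasDerivAt (0 : ℂ) h1).mul h3).deriv
      have h5 : deriv g 0 = _ := h4
      rw [h5]; simp; ring
    have hsd : Differentiable ℂ (fun t => dslope g 0 t + inner ℂ z v * f z) := by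
      have : Differentiable ℂ (dslope g 0) := by
        rw [← differentiableOn_univ]
        exact (Complex.differentiableOn_dslope univ_mem).2 hgd.differentiableOn
      fun_prop
    have hmean := hPm _ hsd
    simp only [dslope_same, hderiv, sub_add_cancel] at hmean
    have e1 : ∀ (r : ℝ) (x : ℂ), 0 ≤ r → ENNReal.ofReal (r * ‖x‖ ^ 2) = ENNReal.ofReal r * ‖x‖ₑ ^ 2 :=
      fun r x hr => by
        rw [ENNReal.ofReal_mul hr, ENNReal.ofReal_pow (norm_nonneg _), ofReal_norm]
    rw [e1 _ _ (by positivity)]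
    calc _ ≤ ENNReal.ofReal ((1 + ‖z‖ ^ 2) ^ k * Real.exp (-‖z‖ ^ 2)) *
          ∫⁻ t, ‖dslope g 0 t + inner ℂ z v * f z‖ₑ ^ 2 ∂P := by gcongr; exact hmean
      _ = ∫⁻ t, ENNReal.ofReal ((1 + ‖z‖ ^ 2) ^ k * Real.exp (-‖z‖ ^ 2)) *
          ‖dslope g 0 t + inner ℂ z v * f z‖ₑ ^ 2 ∂P := by
          rw [lintegral_const_mul']; exact ENNReal.ofReal_ne_top
      _ ≤ ∫⁻ t, (ENNReal.ofReal (2 * Real.exp 1 * 3 ^ k) * ENNReal.ofReal (I k (z + t • v)) +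
          4 * ENNReal.ofReal (I (k + 1) z)) ∂P := by
          refine lintegral_mono_ae ?_
          filter_upwards [hP1] with t ht
          have ht0 : t ≠ 0 := fun h => by simp [h] at ht
          rw [← e1 _ _ (by positivity), ← ENNReal.ofReal_mul (by positivity),
            show (4 : ENNReal) = ENNReal.ofReal 4 by simp, ← ENNReal.ofReal_mul (by positivity),
            ← ENNReal.ofReal_add (by simp only [hI]; positivity) (by simp only [hI]; positivity)]
          refine ENNReal.ofReal_le_ofReal ?_
          rw [dslope_of_ne _ ht0, slope_def_field, sub_zero, div_eq_inv_mul, hg0]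
          exact circle_pointwise k hv1 z ht
      _ = _ := by
          rw [lintegral_add_right _ measurable_const]; simp
  refine lt_of_le_of_lt (lintegral_mono hpt) ?_
  rw [lintegral_add_right _ (by fun_prop), lintegral_lintegral_swap (by fun_prop)]
  have htr : ∀ t : ℂ, ∫⁻ z, ENNReal.ofReal (2 * Real.exp 1 * 3 ^ k) *
      ENNReal.ofReal (I k (z + t • v)) =
      ENNReal.ofReal (2 * Real.exp 1 * 3 ^ k) * ∫⁻ z, ENNReal.ofReal (I k z) := fun t => by
    rw [lintegral_const_mul' _ _ ENNReal.ofReal_ne_top,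
      lintegral_add_right_eq_self (fun z => ENNReal.ofReal (I k z))]
  simp only [htr, lintegral_const, measure_univ, mul_one]
  rw [lintegral_const_mul' _ _ (by simp)]
  exact ENNReal.add_lt_top.2 ⟨ENNReal.mul_lt_top ENNReal.ofReal_lt_top (h.mono (Nat.le_succ k)).2,
    ENNReal.mul_lt_top (by simp) h.2⟩

theorem WInt.multi_mem {n m : ℕ} {f : CSpace n → ℂ} (h : WInt m f) (α : Fin n → ℕ)
    (hα : ∑ j, α j ≤ m) : WInt 0 (multiD α f) := by
  have hit : ∀ (a k : ℕ) (j : Fin n) (g : CSpace n → ℂ), WInt (k + a) g →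
      WInt k ((partialD j)^[a] g) := by
    intro a
    induction a with
    | zero => intro k j g hg; simpa using hg
    | succ a ih =>
      intro k j g hg
      rw [Function.iterate_succ_apply]
      exact ih k j _ (WInt.partial_mem j (by simpa [add_assoc] using hg))
  have hl : ∀ (l : List (Fin n)) (k : ℕ), WInt (k + (l.map α).sum) f →
      WInt k (l.foldr (fun j g => (partialD j)^[α j] g) f) := by
    intro l
    induction l with
    | nil => intro k hk; simpa using hk
    | cons j l ih =>
      intro k hk
      rw [List.foldr_cons]
      refine hit _ _ _ _ (ih _ ?_)
      simpa [add_assoc] using hk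
  refine hl _ 0 (h.mono ?_)
  rw [zero_add, ← Fin.sum_univ_def]; exact hα

theorem density_eq {ρ : ℝ} (hρ : 0 ≤ ρ) (x : ℂ) :
    ENNReal.ofReal ρ * ‖x‖ₑ ^ 2 = ENNReal.ofReal (ρ * ‖x‖ ^ 2) := by
  rw [ENNReal.ofReal_mul hρ, ENNReal.ofReal_pow (norm_nonneg _), ofReal_norm]

theorem lintegral_fockSobolevMeasure (n m : ℕ) [NeZero n] {f : CSpace n → ℂ} :
    ∫⁻ z, ‖f z‖ₑ ^ 2 ∂(fockSobolevMeasure n m) =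
      ∫⁻ z, ENNReal.ofReal (omega n m * ‖z‖ ^ (2 * m) * Real.exp (-‖z‖ ^ 2) * ‖f z‖ ^ 2) := by
  have := omega_pos n m
  rw [fockSobolevMeasure, lintegral_withDensity_eq_lintegral_mul_non_measurable _ (by fun_prop)
    (by simp)]
  refine lintegral_congr fun z => density_eq (by positivity) _

theorem eLpNorm_two_sq {X : Type*} [MeasurableSpace X] (μ : Measure X) (f : X → ℂ) :
    eLpNorm f 2 μ ^ 2 = ∫⁻ z, ‖f z‖ₑ ^ 2 ∂μ := by
  have := eLpNorm_nnreal_pow_eq_lintegral (μ := μ) (f := f) (p := 2) (by simp)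
  simpa using this

/-- Point evaluations of entire functions are locally uniformly bounded. -/
theorem exists_eval_bound (n m : ℕ) [NeZero n] (R : ℝ) : ∃ C : ℝ≥0∞, C ≠ ⊤ ∧
    ∀ f : CSpace n → ℂ, Differentiable ℂ f → ∀ z : CSpace n, ‖z‖ ≤ R →
      ‖f z‖ₑ ^ 2 ≤ C * eLpNorm f 2 (fockSobolevMeasure n m) ^ 2 := by
  wlog hR : 0 ≤ R generalizing R
  · obtain ⟨C, hC, h⟩ := this 0 le_rfl
    exact ⟨C, hC, fun f hf z hz => h f hf z (by linarith)⟩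
  obtain ⟨P, hP, hP1, hPm⟩ := exists_circle_measure
  have hω := omega_pos n m
  set A : Set (CSpace n) := {w | R + 1 < ‖w‖ ∧ ‖w‖ < R + 2} with hA
  have hAo : IsOpen A := (isOpen_lt continuous_const continuous_norm).inter
    (isOpen_lt continuous_norm continuous_const)
  have hAm : MeasurableSet A := hAo.measurableSet
  have hApos : volume A ≠ 0 := by
    refine (hAo.measure_pos volume ⟨EuclideanSpace.single 0 ((R + 3 / 2 : ℝ) : ℂ), ?_⟩).ne'
    have : ‖(EuclideanSpace.single (0 : Fin n) ((R + 3 / 2 : ℝ) : ℂ) : CSpace n)‖ = R + 3 / 2 := by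
      rw [PiLp.norm_single, Complex.norm_real, Real.norm_of_nonneg (by linarith)]
    simp only [hA, Set.mem_ofPred_eq, this]
    constructor <;> linarith
  have hAtop : volume A ≠ ⊤ := by
    refine (lt_of_le_of_lt (measure_mono (?_ : A ⊆ Metric.ball 0 (R + 2)))
      measure_ball_lt_top).ne
    intro w hw; simpa using hw.2
  set c : ℝ := omega n m * Real.exp (-(2 * R + 2) ^ 2) with hc
  have hcpos : 0 < c := by positivity
  refine ⟨(volume A)⁻¹ * (ENNReal.ofReal c)⁻¹, ENNReal.mul_ne_top (by simpa using hApos)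
    (by simpa using hcpos), fun f hf z hz => ?_⟩
  have hfm : Measurable f := hf.continuous.measurable
  have hrot : ∀ᵐ t ∂P, ∫⁻ w, A.indicator (fun w => ‖f (z + t • w)‖ₑ ^ 2) w =
      ∫⁻ w, A.indicator (fun w => ‖f (z + w)‖ₑ ^ 2) w := by
    filter_upwards [hP1] with t ht
    have ht0 : t ≠ 0 := fun h => by simp [h] at ht
    let T : CSpace n ≃ₗᵢ[ℝ] CSpace n :=
      { toLinearEquiv := (LinearEquiv.smulOfNeZero ℂ (CSpace n) t ht0).restrictScalars ℝ
        norm_map' := fun w => by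
          change ‖t • w‖ = ‖w‖
          rw [norm_smul, ht, one_mul] }
    have hT : ∀ w, T w = t • w := fun w => rfl
    rw [← T.measurePreserving.lintegral_comp (f := A.indicator (fun w => ‖f (z + w)‖ₑ ^ 2))
      (Measurable.indicator (by fun_prop) hAm)]
    refine lintegral_congr fun w => ?_
    have : (T w ∈ A) ↔ w ∈ A := by simp only [hA, Set.mem_ofPred_eq, T.norm_map]
    by_cases hw : w ∈ A
    · rw [Set.indicator_of_mem hw, Set.indicator_of_mem (this.2 hw), hT]
    · rw [Set.indicator_of_notMem hw, Set.indicator_of_notMem (mt this.1 hw)]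
  have h1 : ‖f z‖ₑ ^ 2 * volume A ≤ ∫⁻ w, A.indicator (fun w => ‖f (z + w)‖ₑ ^ 2) w := by
    calc ‖f z‖ₑ ^ 2 * volume A = ∫⁻ w, A.indicator (fun _ => ‖f z‖ₑ ^ 2) w := by
          rw [lintegral_indicator hAm]; simp
      _ ≤ ∫⁻ w : CSpace n, ∫⁻ t : ℂ, A.indicator (fun w : CSpace n => ‖f (z + t • w)‖ₑ ^ 2) w ∂P := by
          refine lintegral_mono fun w => ?_
          by_cases hw : w ∈ A
          · simp only [Set.indicator_of_mem hw]
            have := hPm (fun t => f (z + t • w)) (by fun_prop)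
            simpa using this
          · simp [Set.indicator_of_notMem hw]
      _ = ∫⁻ t : ℂ, (∫⁻ w : CSpace n, A.indicator (fun w : CSpace n => ‖f (z + t • w)‖ₑ ^ 2) w) ∂P := by
          rw [lintegral_lintegral_swap]
          have : (Function.uncurry fun (w : CSpace n) (t : ℂ) =>
              (A.indicator (fun w : CSpace n => ‖f (z + t • w)‖ₑ ^ 2) w : ℝ≥0∞)) =
              (Prod.fst ⁻¹' A).indicator (fun p : CSpace n × ℂ => ‖f (z + p.2 • p.1)‖ₑ ^ 2) := by
            ext ⟨w, t⟩; rfl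
          rw [this]
          exact (Measurable.indicator (by fun_prop) (measurable_fst hAm)).aemeasurable
      _ = _ := by rw [lintegral_congr_ae hrot]; simp
  have h2 : ∫⁻ w, A.indicator (fun w => ‖f (z + w)‖ₑ ^ 2) w ≤
      (ENNReal.ofReal c)⁻¹ * eLpNorm f 2 (fockSobolevMeasure n m) ^ 2 := by
    rw [eLpNorm_two_sq, lintegral_fockSobolevMeasure,
      ← lintegral_const_mul' _ _ (by simpa using hcpos),
      ← lintegral_add_left_eq_self (fun v => (ENNReal.ofReal c)⁻¹ *
        ENNReal.ofReal (omega n m * ‖v‖ ^ (2 * m) * Real.exp (-‖v‖ ^ 2) * ‖f v‖ ^ 2)) z]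
    refine lintegral_mono fun w => ?_
    by_cases hw : w ∈ A
    · rw [Set.indicator_of_mem hw, ← density_eq (by positivity), ← mul_assoc]
      have hl : 1 ≤ ‖z + w‖ := by
        have := norm_sub_le (z + w) z
        rw [add_sub_cancel_left] at this
        linarith [hw.1]
      have hu : ‖z + w‖ ≤ 2 * R + 2 := by linarith [norm_add_le z w, hw.2]
      have hcd : c ≤ omega n m * ‖z + w‖ ^ (2 * m) * Real.exp (-‖z + w‖ ^ 2) := by
        rw [hc, mul_assoc]
        have h3 : 1 ≤ ‖z + w‖ ^ (2 * m) := one_le_pow₀ hl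
        have h4 : Real.exp (-(2 * R + 2) ^ 2) ≤ Real.exp (-‖z + w‖ ^ 2) := by
          apply Real.exp_le_exp.2
          have := pow_le_pow_left₀ (norm_nonneg _) hu 2
          linarith
        have h5 : 1 * Real.exp (-(2 * R + 2) ^ 2) ≤ ‖z + w‖ ^ (2 * m) * Real.exp (-‖z + w‖ ^ 2) := by
          gcongr
        rw [one_mul] at h5
        gcongr
      calc ‖f (z + w)‖ₑ ^ 2 = (ENNReal.ofReal c)⁻¹ * ENNReal.ofReal c * ‖f (z + w)‖ₑ ^ 2 := by
            rw [ENNReal.inv_mul_cancel (by simpa using hcpos) ENNReal.ofReal_ne_top, one_mul]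
        _ ≤ _ := by gcongr
    · rw [Set.indicator_of_notMem hw]; exact zero_le
  rw [mul_assoc]
  calc ‖f z‖ₑ ^ 2 = (volume A)⁻¹ * (‖f z‖ₑ ^ 2 * volume A) := by
        rw [mul_comm (‖f z‖ₑ ^ 2), ← mul_assoc, ENNReal.inv_mul_cancel hApos hAtop, one_mul]
    _ ≤ _ := by
        rw [← mul_assoc, ← mul_assoc, mul_assoc, mul_assoc]
        exact mul_le_mul_right (h1.trans h2) _

theorem WInt.of_memLp {n m : ℕ} [NeZero n] {f : CSpace n → ℂ} (hf : Differentiable ℂ f)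
    (h : MemLp f 2 (fockSobolevMeasure n m)) : WInt m f := by
  refine ⟨hf, ?_⟩
  have hω := omega_pos n m
  obtain ⟨M, hM⟩ := (isCompact_closedBall (0 : CSpace n) 1).exists_bound_of_continuousOn
    hf.continuous.continuousOn
  have hfin : ∫⁻ z, ENNReal.ofReal
      (omega n m * ‖z‖ ^ (2 * m) * Real.exp (-‖z‖ ^ 2) * ‖f z‖ ^ 2) < ⊤ := by
    rw [← lintegral_fockSobolevMeasure, ← eLpNorm_two_sq]
    exact ENNReal.pow_lt_top h.2
  set B : Set (CSpace n) := Metric.closedBall 0 1 with hB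
  have hpt : ∀ z, ENNReal.ofReal ((1 + ‖z‖ ^ 2) ^ m * Real.exp (-‖z‖ ^ 2) * ‖f z‖ ^ 2) ≤
      B.indicator (fun _ => ENNReal.ofReal (2 ^ m * M ^ 2)) z +
        ENNReal.ofReal (2 ^ m / omega n m) * ENNReal.ofReal
          (omega n m * ‖z‖ ^ (2 * m) * Real.exp (-‖z‖ ^ 2) * ‖f z‖ ^ 2) := by
    intro z
    by_cases hz : z ∈ B
    · rw [Set.indicator_of_mem hz]
      refine le_trans (ENNReal.ofReal_le_ofReal ?_) le_self_add
      have hz1 : ‖z‖ ≤ 1 := by simpa [hB] using hz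
      have h1 : (1 + ‖z‖ ^ 2) ^ m ≤ 2 ^ m := by
        gcongr; nlinarith [norm_nonneg z]
      have h2 : Real.exp (-‖z‖ ^ 2) ≤ 1 := Real.exp_le_one_iff.2 (by nlinarith [sq_nonneg ‖z‖])
      calc _ ≤ 2 ^ m * 1 * M ^ 2 := by gcongr; exact hM z hz
        _ = _ := by ring
    · rw [Set.indicator_of_notMem hz, zero_add, ← ENNReal.ofReal_mul (by positivity)]
      refine ENNReal.ofReal_le_ofReal ?_
      have hz1 : 1 < ‖z‖ := by simpa [hB] using hz
      have h1 : (1 + ‖z‖ ^ 2) ^ m ≤ 2 ^ m * ‖z‖ ^ (2 * m) := by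
        rw [pow_mul, ← mul_pow]; gcongr; nlinarith
      calc _ ≤ 2 ^ m * ‖z‖ ^ (2 * m) * Real.exp (-‖z‖ ^ 2) * ‖f z‖ ^ 2 := by gcongr
        _ = _ := by field_simp
  refine lt_of_le_of_lt (lintegral_mono hpt) ?_
  rw [lintegral_add_left (measurable_const.indicator Metric.isClosed_closedBall.measurableSet),
    lintegral_const_mul' _ _ ENNReal.ofReal_ne_top,
    lintegral_indicator Metric.isClosed_closedBall.measurableSet]
  refine ENNReal.add_lt_top.2 ⟨?_, ENNReal.mul_lt_top ENNReal.ofReal_lt_top hfin⟩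
  simp only [lintegral_const, Measure.restrict_apply_univ]
  exact ENNReal.mul_lt_top ENNReal.ofReal_lt_top measure_closedBall_lt_top

/-- An entire function of `L²_m` belongs to the Fock–Sobolev space. -/
theorem IsFockSobolev.of_memLp {n m : ℕ} [NeZero n] {f : CSpace n → ℂ} (hf : Differentiable ℂ f)
    (h : MemLp f 2 (fockSobolevMeasure n m)) : IsFockSobolev n m f := by
  refine ⟨hf, fun α hα => ?_⟩
  obtain ⟨hd, hi⟩ := (WInt.of_memLp hf h).multi_mem α hα
  refine ⟨hd.continuous.aestronglyMeasurable, ?_⟩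
  have h2 : eLpNorm (multiD α f) 2 (fockMeasure n) ^ 2 < ⊤ := by
    rw [eLpNorm_two_sq, fockMeasure, lintegral_withDensity_eq_lintegral_mul_non_measurable _
      (by fun_prop) (by simp)]
    have : ∀ z, ((fun z : CSpace n => ENNReal.ofReal (1 / Real.pi ^ n * Real.exp (-‖z‖ ^ 2))) *
        fun z => ‖multiD α f z‖ₑ ^ 2) z = ENNReal.ofReal (1 / Real.pi ^ n) *
        ENNReal.ofReal ((1 + ‖z‖ ^ 2) ^ 0 * Real.exp (-‖z‖ ^ 2) * ‖multiD α f z‖ ^ 2) := fun z => by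
      rw [Pi.mul_apply, density_eq (by positivity), ← ENNReal.ofReal_mul (by positivity)]
      congr 1; ring
    simp only [this]
    rw [lintegral_const_mul' _ _ ENNReal.ofReal_ne_top]
    exact ENNReal.mul_lt_top ENNReal.ofReal_lt_top hi
  by_contra hcon
  rw [not_lt, top_le_iff] at hcon
  simp [hcon] at h2

theorem partialD_add {n : ℕ} (j : Fin n) {f g : CSpace n → ℂ} (hf : Differentiable ℂ f)
    (hg : Differentiable ℂ g) : partialD j (f + g) = partialD j f + partialD j g := by
  ext z; simp [partialD, fderiv_add (hf z) (hg z)]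

theorem partialD_smul {n : ℕ} (j : Fin n) {f : CSpace n → ℂ} (c : ℂ)
    (hf : Differentiable ℂ f) : partialD j (c • f) = c • partialD j f := by
  ext z; simp [partialD, fderiv_const_smul (hf z)]

theorem multiD_linear {n : ℕ} (α : Fin n → ℕ) {f g : CSpace n → ℂ} (c : ℂ)
    (hf : Differentiable ℂ f) (hg : Differentiable ℂ g) :
    multiD α (f + c • g) = multiD α f + c • multiD α g := by
  have hit : ∀ (a : ℕ) (j : Fin n) (f g : CSpace n → ℂ), Differentiable ℂ f → Differentiable ℂ g →
      (Differentiable ℂ ((partialD j)^[a] f) ∧ (partialD j)^[a] (f + c • g) =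
        (partialD j)^[a] f + c • (partialD j)^[a] g) := by
    intro a j
    induction a with
    | zero => intro f g hf hg; exact ⟨hf, rfl⟩
    | succ a ih =>
      intro f g hf hg
      have hf' : Differentiable ℂ (partialD j f) := differentiable_fderiv_apply hf _
      have hg' : Differentiable ℂ (partialD j g) := differentiable_fderiv_apply hg _
      simp only [Function.iterate_succ_apply]
      rw [partialD_add j hf (hg.const_smul c), partialD_smul j c hg]
      exact ih _ _ hf' hg'
  have hl : ∀ l : List (Fin n), ∀ f g : CSpace n → ℂ, Differentiable ℂ f → Differentiable ℂ g →
      (Differentiable ℂ (l.foldr (fun j g => (partialD j)^[α j] g) f) ∧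
      l.foldr (fun j g => (partialD j)^[α j] g) (f + c • g) =
        l.foldr (fun j g => (partialD j)^[α j] g) f +
          c • l.foldr (fun j g => (partialD j)^[α j] g) g) := by
    intro l
    induction l with
    | nil => intro f g hf hg; exact ⟨hf, rfl⟩
    | cons j l ih =>
      intro f g hf hg
      obtain ⟨h1, h2⟩ := ih f g hf hg
      obtain ⟨h3, -⟩ := ih g f hg hf
      simp only [List.foldr_cons]
      rw [h2]
      exact hit _ _ _ _ h1 h3
  exact (hl _ f g hf hg).2

theorem IsFockSobolev.add_smul {n m : ℕ} {f g : CSpace n → ℂ} (c : ℂ) (hf : IsFockSobolev n m f)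
    (hg : IsFockSobolev n m g) : IsFockSobolev n m (f + c • g) :=
  ⟨hf.entire.add (hg.entire.const_smul c), fun α hα => by
    rw [multiD_linear α c hf.entire hg.entire]
    exact (hf.memLp α hα).add ((hg.memLp α hα).const_smul c)⟩

theorem IsFockSobolev.zero (n m : ℕ) : IsFockSobolev n m (0 : CSpace n → ℂ) := by
  have h : ∀ α : Fin n → ℕ, multiD α (0 : CSpace n → ℂ) = 0 := fun α => by
    have := multiD_linear α (f := 0) (g := 0) (-1) (differentiable_const (0:ℂ))
      (differentiable_const (0:ℂ))
    simpa using this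
  exact ⟨differentiable_const (0:ℂ), fun α _ => by rw [h]; exact MemLp.zero⟩

/-- The Hilbert space `L²_m = L²(ℂⁿ, dV_m)`. -/
abbrev L2Space (n m : ℕ) : Type := Lp ℂ 2 (fockSobolevMeasure n m)

/-- The Fock–Sobolev space `F^{2,m}`, as a subspace of `L²_m` with the norm of `L²_m`. -/
def fockSobolev (n m : ℕ) : Submodule ℂ (L2Space n m) where
  carrier := {u | ∃ f : CSpace n → ℂ, IsFockSobolev n m f ∧ u =ᵐ[fockSobolevMeasure n m] f}
  zero_mem' := ⟨0, IsFockSobolev.zero n m, Lp.coeFn_zero _ _ _⟩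
  add_mem' := by
    rintro u v ⟨f, hf, huf⟩ ⟨g, hg, hvg⟩
    refine ⟨f + (1 : ℂ) • g, hf.add_smul 1 hg, ?_⟩
    rw [one_smul]
    exact (Lp.coeFn_add u v).trans (huf.add hvg)
  smul_mem' := by
    rintro c u ⟨f, hf, huf⟩
    refine ⟨0 + c • f, (IsFockSobolev.zero n m).add_smul c hf, ?_⟩
    rw [zero_add]
    exact (Lp.coeFn_smul c u).trans (huf.const_smul c)

/-- `F^{2,m}` is closed in `L²_m`, so that the orthogonal projection onto it exists. -/
theorem isClosed_fockSobolev (n m : ℕ) [NeZero n] :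
    IsClosed (fockSobolev n m : Set (L2Space n m)) := by
  refine IsSeqClosed.isClosed fun u u₀ hu hlim => ?_
  choose f hf huf using hu
  have hd : ∀ k, Differentiable ℂ (f k) := fun k => (hf k).entire
  have hnorm : ∀ k l, eLpNorm (f k - f l) 2 (fockSobolevMeasure n m) =
      ENNReal.ofReal ‖u k - u l‖ := fun k l => by
    rw [Lp.norm_def, ENNReal.ofReal_toReal (Lp.eLpNorm_ne_top _)]
    refine eLpNorm_congr_ae ?_
    exact ((Lp.coeFn_sub (u k) (u l)).trans ((huf k).sub (huf l))).symm
  have hC : ∀ R : ℝ, UniformCauchySeqOn f atTop (Metric.ball 0 R) := by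
    intro R
    obtain ⟨C, hC, hb⟩ := exists_eval_bound n m R
    have hb' : ∀ k l z, ‖z‖ ≤ R → ‖f k z - f l z‖ ^ 2 ≤ C.toReal * ‖u k - u l‖ ^ 2 := by
      intro k l z hz
      have h1 := hb (f k - f l) ((hd k).sub (hd l)) z hz
      rw [hnorm, ← ENNReal.ofReal_pow (norm_nonneg _)] at h1
      have h2 := ENNReal.toReal_mono (ENNReal.mul_ne_top hC ENNReal.ofReal_ne_top) h1
      simpa [ENNReal.toReal_mul, ENNReal.toReal_ofReal] using h2
    rw [Metric.uniformCauchySeqOn_iff]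
    intro ε hε
    have hCpos : 0 < C.toReal + 1 := by positivity
    obtain ⟨N, hN⟩ := Metric.cauchySeq_iff.1 hlim.cauchySeq (ε / Real.sqrt (C.toReal + 1))
      (by positivity)
    refine ⟨N, fun k hk l hl z hz => ?_⟩
    have h1 := hN k hk l hl
    rw [dist_eq_norm, lt_div_iff₀ (by positivity)] at h1
    have h2 := hb' k l z (by simpa using (Metric.mem_ball.1 hz).le)
    rw [dist_eq_norm]
    refine lt_of_pow_lt_pow_left₀ 2 hε.le (h2.trans_lt ?_)
    have h3 := pow_lt_pow_left₀ h1 (by positivity) two_ne_zero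
    rw [mul_pow, Real.sq_sqrt hCpos.le] at h3
    nlinarith [sq_nonneg ‖u k - u l‖]
  have hlimf : ∀ z, ∃ L, Tendsto (fun k => f k z) atTop (𝓝 L) := fun z =>
    cauchySeq_tendsto_of_complete ((hC (‖z‖ + 1)).cauchySeq (x := z) (by simp))
  choose F hF using hlimf
  have hFd : Differentiable ℂ F := differentiable_of_tendsto_entire hd fun R =>
    (hC R).tendstoUniformlyOn_of_tendsto fun z _ => hF z
  have hFu : u₀ =ᵐ[fockSobolevMeasure n m] F := by
    obtain ⟨φ, hφ, hae⟩ := (tendstoInMeasure_of_tendsto_Lp hlim).exists_seq_tendsto_ae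
    have hall : ∀ᵐ z ∂(fockSobolevMeasure n m), ∀ k, u k z = f k z := ae_all_iff.2 huf
    filter_upwards [hae, hall] with z h1 h2
    refine tendsto_nhds_unique h1 ?_
    simp only [h2]
    exact (hF z).comp hφ.tendsto_atTop
  exact ⟨F, IsFockSobolev.of_memLp hFd ((memLp_congr_ae hFu).1 (Lp.memLp u₀)), hFu⟩

instance fockSobolev_hasOrthogonalProjection (n m : ℕ) [NeZero n] : (fockSobolev n m).HasOrthogonalProjection :=
  haveI : CompleteSpace (fockSobolev n m) := (isClosed_fockSobolev n m).completeSpace_coe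
  inferInstance

/-- The space of those `g ∈ F^{2,m}` for which the product `f g` lies in `L²_m`. -/
def hankelDomain (n m : ℕ) (f : CSpace n → ℂ) : Submodule ℂ (fockSobolev n m) where
  carrier := {g | MemLp (fun z => f z * g.1 z) 2 (fockSobolevMeasure n m)}
  zero_mem' := by
    refine (memLp_congr_ae ?_).2 (MemLp.zero (ε := ℂ))
    filter_upwards [Lp.coeFn_zero ℂ 2 (fockSobolevMeasure n m)] with z hz
    change f z * (0 : L2Space n m) z = 0
    rw [hz, Pi.zero_apply, mul_zero]
  add_mem' := by
    intro g h hg hh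
    refine (memLp_congr_ae ?_).2 (MemLp.add hg hh)
    filter_upwards [Lp.coeFn_add g.1 h.1] with z hz
    change f z * (g.1 + h.1) z = f z * g.1 z + f z * h.1 z
    rw [hz, Pi.add_apply, mul_add]
  smul_mem' := by
    intro c g hg
    refine (memLp_congr_ae ?_).2 (MemLp.const_smul hg c)
    filter_upwards [Lp.coeFn_smul c g.1] with z hz
    change f z * (c • g.1) z = c * (f z * g.1 z)
    rw [hz, Pi.smul_apply, smul_eq_mul, mul_left_comm]

theorem memLp_of_mem_hankelDomain {n m : ℕ} {f : CSpace n → ℂ} (g : hankelDomain n m f) :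
    MemLp (fun z => f z * g.1.1 z) 2 (fockSobolevMeasure n m) := g.2

/-- Multiplication by the symbol, `g ↦ f g`, as a map into `L²_m`. -/
noncomputable def symbolMul (n m : ℕ) (f : CSpace n → ℂ) :
    hankelDomain n m f →ₗ[ℂ] L2Space n m where
  toFun g := (memLp_of_mem_hankelDomain g).toLp (fun z => f z * g.1.1 z)
  map_add' g h := by
    rw [← MemLp.toLp_add]
    refine MemLp.toLp_congr _ _ ?_
    filter_upwards [Lp.coeFn_add g.1.1 h.1.1] with z hz
    change f z * (g.1.1 + h.1.1) z = f z * g.1.1 z + f z * h.1.1 z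
    rw [hz, Pi.add_apply, mul_add]
  map_smul' c g := by
    rw [RingHom.id_apply, ← MemLp.toLp_const_smul]
    refine MemLp.toLp_congr _ _ ?_
    filter_upwards [Lp.coeFn_smul c g.1.1] with z hz
    change f z * (c • g.1.1) z = c * (f z * g.1.1 z)
    rw [hz, Pi.smul_apply, smul_eq_mul, mul_left_comm]

/-- The orthogonal projection `P_m` of `L²_m` onto `F^{2,m}`. -/
noncomputable def fockProj (n m : ℕ) [NeZero n] : L2Space n m →L[ℂ] L2Space n m :=
  (fockSobolev n m).starProjection

/-- The Hankel operator `H_f g = (I - P_m)(f g)`, from `F^{2,m}` to `L²_m`, on its maximal domain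
`{g ∈ F^{2,m} : f g ∈ L²_m}`. -/
noncomputable def hankel (n m : ℕ) [NeZero n] (f : CSpace n → ℂ) :
    fockSobolev n m →ₗ.[ℂ] L2Space n m where
  domain := hankelDomain n m f
  toFun := (LinearMap.id - (fockProj n m : L2Space n m →ₗ[ℂ] L2Space n m)) ∘ₗ symbolMul n m f

/-- `H_f` is compact on `F^{2,m}`: it is the restriction to its domain of a compact linear operator
`F^{2,m} → L²_m`. -/
def HankelCompact (n m : ℕ) [NeZero n] (f : CSpace n → ℂ) : Prop :=
  ∃ T : fockSobolev n m →L[ℂ] L2Space n m, IsCompactOperator T ∧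
    ∀ g : (hankel n m f).domain, T g = hankel n m f g

/-- The function `z ↦ p(z, z̄)` on `ℂⁿ` given by a polynomial `p` in the `2n` variables
`z₁, …, zₙ, z̄₁, …, z̄ₙ`. -/
noncomputable def polySymbol {n : ℕ} (p : MvPolynomial (Fin n ⊕ Fin n) ℂ) : CSpace n → ℂ :=
  fun z => MvPolynomial.eval (Sum.elim (fun j => z j) fun j => starRingEnd ℂ (z j)) p

end FockSobolev

/-! If `f` is holomorphic and `f g` lies in `L²_m`, then `f g` is an entire function of `L²_m`,
hence already in `F^{2,m}`. So `H_f` vanishes on its domain and `T = 0` is a compact extension.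

For the converse, `T` is tested on the coherent states `g_v`, which are bounded in `L²_m` for `|v| ≥
1` and tend to `0` pointwise as `|v| → ∞`. By definition `T g_v = f g_v - h` with `h` entire. For a
complex linear form `l` and `r ≤ 1`, put `φ_w(u) = ∫_{B(w,r)} (u / g_w) l(z - w) dv`. These
functionals are bounded on `L²_m` uniformly in `|w| ≥ 2` (`exists_momentFunctional`). They do not
see `h`, because `(h / g_w) l(· - w)` is entire and vanishes at the centre of the ball. Hence `φ_w(T
g_w) = ∫_{B(0,r)} f(w + z) l(z) dv(z)`, a local moment of `f` at `w`.

Let `v_k → ∞`. By compactness `T g_{v_k} → y` in norm along a subsequence. For a fixed index `k`,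
`φ_{v_k}(T g_{v_j}) → 0` as `j → ∞`, so `φ_{v_k}(y) = 0`. The uniform bound then gives `φ_{v_k}(T
g_{v_k}) → 0` along the subsequence: the moments of `f` at `v_k` tend to `0`. With `v_k` on a real
line through an arbitrary point `w`, the moment is a polynomial in the line parameter, so it is
identically zero, in particular at `w` (`setIntegral_polySymbol_mul_eq_zero`).

Finally, vanishing of all these moments on small balls forces the conjugate-linear part of the real
derivative to vanish, which is the Cauchy–Riemann system
(`differentiableAt_complex_of_setIntegral_eq_zero`). -/

namespace FockSobolev

/-! ### Coherent states and Gaussian estimates -/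

/-- The weighted coherent state `exp(⟨w, z⟩ - |w|² / 2) / |w|^m`. -/
noncomputable def coherent {n : ℕ} (m : ℕ) (w z : CSpace n) : ℂ :=
  Complex.exp (inner ℂ w z - ((‖w‖ ^ 2 / 2 : ℝ) : ℂ)) / ((‖w‖ ^ m : ℝ) : ℂ)

theorem differentiable_coherent {n : ℕ} (m : ℕ) (w : CSpace n) :
    Differentiable ℂ (coherent m w) := by
  have h : Differentiable ℂ fun z : CSpace n => inner ℂ w z := (innerSL ℂ w).differentiable
  unfold coherent
  fun_prop

theorem continuous_coherent {n : ℕ} (m : ℕ) (w : CSpace n) : Continuous (coherent m w) :=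
  (differentiable_coherent m w).continuous

/-- Completing the square. Against the weight `e^{-|z|²}`, the coherent state becomes a Gaussian
centred at `w`, which makes all later estimates translation invariant. -/
theorem norm_coherent_sq {n : ℕ} (m : ℕ) (w z : CSpace n) :
    ‖coherent m w z‖ ^ 2 = Real.exp (‖z‖ ^ 2) * Real.exp (-‖z - w‖ ^ 2) / ‖w‖ ^ (2 * m) := by
  have h : ‖z - w‖ ^ 2 = ‖z‖ ^ 2 - 2 * (inner ℂ w z : ℂ).re + ‖w‖ ^ 2 := by
    have h1 : (inner ℂ z w : ℂ).re = (inner ℂ w z : ℂ).re := inner_re_symm (𝕜 := ℂ) z w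
    rw [@norm_sub_sq ℂ, ← h1]; rfl
  rw [coherent, norm_div, div_pow, Complex.norm_exp, Complex.norm_real,
    Real.norm_of_nonneg (by positivity), ← pow_mul, mul_comm m 2, ← Real.exp_nat_mul,
    ← Real.exp_add, h]
  congr 2
  simp only [Complex.sub_re, Complex.ofReal_re]
  push_cast; ring

theorem coherent_ne_zero {n : ℕ} (m : ℕ) {w : CSpace n} (hw : w ≠ 0) (z : CSpace n) :
    coherent m w z ≠ 0 := by
  simp [coherent, Complex.exp_ne_zero, hw]

/-- Half of the Gaussian absorbs the polynomial factor: `(1 + x)^N ≤ N! e^{1 + x}` and `1 + x - x² ≤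
2 - x²/2`. -/
theorem lintegral_one_add_norm_pow_mul_exp_lt_top (n N : ℕ) (c : ℝ) :
    ∫⁻ z : CSpace n, ENNReal.ofReal (c * ((1 + ‖z‖) ^ N * Real.exp (-‖z‖ ^ 2))) < ⊤ := by
  have hg : Integrable fun z : CSpace n => Real.exp (-(1 / 2) * ‖z‖ ^ 2) := by
    have := (GaussianFourier.integrable_cexp_neg_mul_sq_norm_add (V := CSpace n) (b := 1 / 2)
      (by norm_num) 0 0).norm
    refine this.congr (ae_of_all _ fun z => ?_)
    simp only [zero_mul, add_zero, Complex.norm_exp]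
    congr 1
    rw [show (-(1 / 2 : ℂ) * (‖z‖ : ℂ) ^ 2) = ((-(1 / 2) * ‖z‖ ^ 2 : ℝ) : ℂ) by push_cast; ring,
      Complex.ofReal_re]
  refine lt_of_le_of_lt (lintegral_mono fun z => ENNReal.ofReal_le_ofReal ?_)
    (hg.const_mul (|c| * (N.factorial * Real.exp 2))).lintegral_lt_top
  have h1 := Real.pow_div_factorial_le_exp (1 + ‖z‖) (by positivity) N
  rw [div_le_iff₀ (by positivity)] at h1
  have h2 : Real.exp (1 + ‖z‖) * Real.exp (-‖z‖ ^ 2) ≤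
      Real.exp 2 * Real.exp (-(1 / 2) * ‖z‖ ^ 2) := by
    rw [← Real.exp_add, ← Real.exp_add]
    apply Real.exp_le_exp.2
    nlinarith [sq_nonneg (‖z‖ - 1)]
  calc c * ((1 + ‖z‖) ^ N * Real.exp (-‖z‖ ^ 2)) ≤
      |c| * ((Real.exp (1 + ‖z‖) * N.factorial) * Real.exp (-‖z‖ ^ 2)) := by
        gcongr; exact le_abs_self c
    _ = |c| * N.factorial * (Real.exp (1 + ‖z‖) * Real.exp (-‖z‖ ^ 2)) := by ring
    _ ≤ |c| * N.factorial * (Real.exp 2 * Real.exp (-(1 / 2) * ‖z‖ ^ 2)) := by gcongr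
    _ = _ := by ring

theorem norm_le_norm_mul_one_add {E : Type*} [SeminormedAddCommGroup E] {w : E} (hw : 1 ≤ ‖w‖)
    (z : E) : ‖z‖ ≤ ‖w‖ * (1 + ‖z - w‖) := by
  have : ‖z‖ ≤ ‖w‖ + ‖z - w‖ := by simpa using norm_add_le w (z - w)
  nlinarith [norm_nonneg (z - w)]

/-- The factor `|w|^{-m}` in the coherent state offsets the weight `|z|^{2m}`, since `|z| / |w| ≤ 1
+ |z - w|` for `|w| ≥ 1`. After translation by `w` the bound depends on `w` only through the growth
constant `C`. -/
theorem eLpNorm_mul_coherent_sq_le (n m : ℕ) [NeZero n] {w : CSpace n} (hw : 1 ≤ ‖w‖)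
    {F : CSpace n → ℂ} {C : ℝ} {N : ℕ} (hF : ∀ z, ‖F z‖ ≤ C * (1 + ‖z - w‖) ^ N) :
    eLpNorm (fun z => F z * coherent m w z) 2 (fockSobolevMeasure n m) ^ 2 ≤
      ∫⁻ z : CSpace n, ENNReal.ofReal
        ((omega n m * C ^ 2) * ((1 + ‖z‖) ^ (2 * m + N * 2) * Real.exp (-‖z‖ ^ 2))) := by
  have hω := omega_pos n m
  rw [eLpNorm_two_sq, lintegral_fockSobolevMeasure,
    ← lintegral_sub_right_eq_self (fun z => ENNReal.ofReal
        ((omega n m * C ^ 2) * ((1 + ‖z‖) ^ (2 * m + N * 2) * Real.exp (-‖z‖ ^ 2)))) w]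
  refine lintegral_mono fun z => ENNReal.ofReal_le_ofReal ?_
  have hw0 : 0 < ‖w‖ := by linarith
  rw [norm_mul, mul_pow, norm_coherent_sq]
  have h1 : ‖z‖ ^ (2 * m) / ‖w‖ ^ (2 * m) ≤ (1 + ‖z - w‖) ^ (2 * m) := by
    rw [div_le_iff₀ (by positivity), ← mul_pow, mul_comm _ ‖w‖]
    gcongr
    exact norm_le_norm_mul_one_add hw z
  have h2 : ‖F z‖ ^ 2 ≤ C ^ 2 * (1 + ‖z - w‖) ^ (N * 2) := by
    rw [pow_mul, ← mul_pow]
    exact pow_le_pow_left₀ (norm_nonneg _) (hF z) 2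
  have h3 : Real.exp (-‖z‖ ^ 2) * Real.exp (‖z‖ ^ 2) = 1 := by
    rw [← Real.exp_add]; simp
  calc _ = omega n m * (‖z‖ ^ (2 * m) / ‖w‖ ^ (2 * m)) * ‖F z‖ ^ 2 * Real.exp (-‖z - w‖ ^ 2) *
        (Real.exp (-‖z‖ ^ 2) * Real.exp (‖z‖ ^ 2)) := by ring
    _ ≤ omega n m * (1 + ‖z - w‖) ^ (2 * m) * (C ^ 2 * (1 + ‖z - w‖) ^ (N * 2)) *
        Real.exp (-‖z - w‖ ^ 2) := by
      rw [h3, mul_one]; gcongr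
    _ = _ := by rw [pow_add]; ring

theorem memLp_mul_coherent (n m : ℕ) [NeZero n] {w : CSpace n} (hw : 1 ≤ ‖w‖)
    {F : CSpace n → ℂ} (hFc : Continuous F) {C : ℝ} {N : ℕ}
    (hF : ∀ z, ‖F z‖ ≤ C * (1 + ‖z‖) ^ N) :
    MemLp (fun z => F z * coherent m w z) 2 (fockSobolevMeasure n m) := by
  refine ⟨(hFc.mul (continuous_coherent m w)).aestronglyMeasurable, ?_⟩
  have hC : 0 ≤ C := by
    have := (norm_nonneg _).trans (hF 0)
    simpa using this
  -- Recentring the growth bound at `w` costs `1 + |z| ≤ 2 |w| (1 + |z - w|)`. The constant now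
  -- depends on `w`, which is harmless for mere membership.
  have h := (eLpNorm_mul_coherent_sq_le n m hw (F := F) (C := C * (2 * ‖w‖) ^ N) (N := N)
    fun z => (hF z).trans (by
      rw [mul_assoc, ← mul_pow]
      gcongr
      have := norm_le_norm_mul_one_add hw z
      nlinarith [norm_nonneg (z - w)])).trans_lt
    (lintegral_one_add_norm_pow_mul_exp_lt_top n _ _)
  exact (ENNReal.pow_lt_top_iff.1 h).resolve_right two_ne_zero

theorem exists_eLpNorm_coherent_le (n m : ℕ) [NeZero n] : ∃ C : ℝ, ∀ w : CSpace n, 1 ≤ ‖w‖ →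
    eLpNorm (coherent m w) 2 (fockSobolevMeasure n m) ≤ ENNReal.ofReal C := by
  set I := ∫⁻ z : CSpace n, ENNReal.ofReal
        ((omega n m * 1 ^ 2) * ((1 + ‖z‖) ^ (2 * m + 0 * 2) * Real.exp (-‖z‖ ^ 2))) with hI
  have hIt : I < ⊤ := lintegral_one_add_norm_pow_mul_exp_lt_top n _ _
  refine ⟨I.toReal + 1, fun w hw => ?_⟩
  have h := eLpNorm_mul_coherent_sq_le n m hw (F := fun _ => 1) (C := 1) (N := 0) (by simp)
  simp only [one_mul] at h
  rw [← not_lt]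
  intro hlt
  have h1 : ENNReal.ofReal (I.toReal + 1) ^ 2 ≤ I := by
    refine le_trans ?_ h
    gcongr
  rw [← ENNReal.ofReal_pow (by positivity)] at h1
  have h2 := (ENNReal.ofReal_le_iff_le_toReal hIt.ne).1 h1
  -- `I` bounds the square of the norm, and `(I + 1)² ≤ I` is impossible for `I ≥ 0`; this spares a
  -- square root.
  nlinarith [I.toReal_nonneg]

/-! ### Polynomial symbols: growth, real differentiability, restriction to lines -/

theorem exists_polySymbol_bound {n : ℕ} (p : MvPolynomial (Fin n ⊕ Fin n) ℂ) :
    ∃ (C : ℝ) (N : ℕ), ∀ z : CSpace n, ‖polySymbol p z‖ ≤ C * (1 + ‖z‖) ^ N := by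
  induction p using MvPolynomial.induction_on with
  | C a => exact ⟨‖a‖, 0, fun z => by simp [polySymbol]⟩
  | add p q hp hq =>
    obtain ⟨C, N, hp⟩ := hp
    obtain ⟨D, M, hq⟩ := hq
    refine ⟨|C| + |D|, N + M, fun z => ?_⟩
    have hz : 1 ≤ 1 + ‖z‖ := by simp
    have h1 : (1 + ‖z‖) ^ N ≤ (1 + ‖z‖) ^ (N + M) := pow_le_pow_right₀ hz (by omega)
    have h2 : (1 + ‖z‖) ^ M ≤ (1 + ‖z‖) ^ (N + M) := pow_le_pow_right₀ hz (by omega)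
    have h3 : polySymbol (p + q) z = polySymbol p z + polySymbol q z := by simp [polySymbol]
    rw [h3]
    calc _ ≤ ‖polySymbol p z‖ + ‖polySymbol q z‖ := norm_add_le _ _
      _ ≤ C * (1 + ‖z‖) ^ N + D * (1 + ‖z‖) ^ M := add_le_add (hp z) (hq z)
      _ ≤ |C| * (1 + ‖z‖) ^ (N + M) + |D| * (1 + ‖z‖) ^ (N + M) := by
        gcongr <;> exact le_abs_self _
      _ = _ := by ring
  | mul_X p i hp =>
    obtain ⟨C, N, hp⟩ := hp
    refine ⟨C, N + 1, fun z => ?_⟩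
    have h1 : ‖Sum.elim (fun j => z j) (fun j => starRingEnd ℂ (z j)) i‖ ≤ 1 + ‖z‖ := by
      have h2 := fun j => PiLp.norm_apply_le z j
      rcases i with j | j
      · have := h2 j
        simp only [Sum.elim_inl]; linarith
      · have := h2 j
        simp only [Sum.elim_inr, RCLike.norm_conj]; linarith
    have h3 : polySymbol (p * MvPolynomial.X i) z = polySymbol p z *
      Sum.elim (fun j => z j) (fun j => starRingEnd ℂ (z j)) i := by simp [polySymbol]
    rw [h3, norm_mul, pow_succ, ← mul_assoc]
    exact mul_le_mul (hp z) h1 (norm_nonneg _) ((norm_nonneg _).trans (hp z))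

theorem differentiable_real_polySymbol {n : ℕ} (p : MvPolynomial (Fin n ⊕ Fin n) ℂ) :
    Differentiable ℝ (polySymbol p : CSpace n → ℂ) := by
  induction p using MvPolynomial.induction_on with
  | C a =>
    have h3 : (polySymbol (MvPolynomial.C a) : CSpace n → ℂ) = fun _ => a := by
      ext; simp [polySymbol]
    rw [h3]; exact differentiable_const a
  | add p q hp hq =>
    have h3 : (polySymbol (p + q) : CSpace n → ℂ) = polySymbol p + polySymbol q := by
      ext; simp [polySymbol]
    rw [h3]; exact hp.add hq
  | mul_X p i hp =>
    have h3 : (polySymbol (p * MvPolynomial.X i) : CSpace n → ℂ) = fun z => polySymbol p z *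
      Sum.elim (fun j => z j) (fun j => starRingEnd ℂ (z j)) i := by ext; simp [polySymbol]
    rw [h3]
    refine hp.mul ?_
    have h : ∀ j, Differentiable ℝ fun z : CSpace n => z j := fun j =>
      ((EuclideanSpace.proj j : CSpace n →L[ℂ] ℂ).restrictScalars ℝ).differentiable
    rcases i with j | j
    · exact h j
    · exact Complex.conjCLE.differentiable.comp (h j)

theorem continuous_polySymbol {n : ℕ} (p : MvPolynomial (Fin n ⊕ Fin n) ℂ) :
    Continuous (polySymbol p : CSpace n → ℂ) := (differentiable_real_polySymbol p).continuous

/-- On a real line, translates of the symbol are polynomial in the parameter. -/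
theorem exists_polynomial_polySymbol_line {n : ℕ} (p : MvPolynomial (Fin n ⊕ Fin n) ℂ)
    (e : CSpace n) : ∃ Q : Polynomial C(CSpace n, ℂ), ∀ (t : ℝ) (z : CSpace n),
      polySymbol p (z + (t : ℂ) • e) =
        ∑ i ∈ Finset.range (Q.natDegree + 1), (t : ℂ) ^ i * Q.coeff i z := by
  let co (j : Fin n) : C(CSpace n, ℂ) := ⟨fun z => z j, by fun_prop⟩
  -- Since `t` is real, conjugating `z_j + t e_j` gives again a polynomial of degree at most one in
  -- `t`. The coefficients are kept as continuous functions of `z`, so that they can be integrated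
  -- over balls later.
  let V : Fin n ⊕ Fin n → Polynomial C(CSpace n, ℂ) := Sum.elim
    (fun j => Polynomial.C (co j) + Polynomial.C (ContinuousMap.const _ (e j)) * Polynomial.X)
    (fun j => Polynomial.C (star (co j)) +
      Polynomial.C (ContinuousMap.const _ (starRingEnd ℂ (e j))) * Polynomial.X)
  refine ⟨MvPolynomial.eval₂ ((Polynomial.C : C(CSpace n, ℂ) →+* _).comp
    (algebraMap ℂ C(CSpace n, ℂ))) V p, fun t z => ?_⟩
  set Q := MvPolynomial.eval₂ ((Polynomial.C : C(CSpace n, ℂ) →+* _).comp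
    (algebraMap ℂ C(CSpace n, ℂ))) V p with hQ
  have h1 : ∑ i ∈ Finset.range (Q.natDegree + 1), (t : ℂ) ^ i * Q.coeff i z =
      (Q.eval (ContinuousMap.const _ (t : ℂ))) z := by
    rw [Polynomial.eval_eq_sum_range]
    simp [mul_comm]
  rw [h1, hQ]
  clear h1 hQ Q
  induction p using MvPolynomial.induction_on with
  | C a => simp [polySymbol]
  | add p q hp hq =>
    have h3 : ∀ z : CSpace n, polySymbol (p + q) z = polySymbol p z + polySymbol q z := by
      simp [polySymbol]
    rw [h3, hp, hq]; simp
  | mul_X p i hp =>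
    have h3 : ∀ z : CSpace n, polySymbol (p * MvPolynomial.X i) z = polySymbol p z *
      Sum.elim (fun j => z j) (fun j => starRingEnd ℂ (z j)) i := by simp [polySymbol]
    rw [h3, hp]
    rcases i with j | j <;> simp [V, co, mul_comm (e j), mul_comm (starRingEnd ℂ (e j))]

/-! ### Moments over balls and a Cauchy–Riemann criterion -/

theorem setIntegral_ball_smul_of_norm_eq_one {n : ℕ} (r : ℝ) {t : ℂ} (ht : ‖t‖ = 1)
    (F : CSpace n → ℂ) :
    ∫ z in Metric.ball (0 : CSpace n) r, F (t • z) = ∫ z in Metric.ball (0 : CSpace n) r, F z := by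
  have ht0 : t ≠ 0 := fun h => by simp [h] at ht
  let T : CSpace n ≃ₗᵢ[ℝ] CSpace n :=
    { toLinearEquiv := (LinearEquiv.smulOfNeZero ℂ (CSpace n) t ht0).restrictScalars ℝ
      norm_map' := fun w => by
        change ‖t • w‖ = ‖w‖
        rw [norm_smul, ht, one_mul] }
  have h := T.measurePreserving.setIntegral_preimage_emb
    T.toHomeomorph.measurableEmbedding F (Metric.ball 0 r)
  have hpre : T ⁻¹' (Metric.ball 0 r) = Metric.ball 0 r := by
    ext z
    simp
  rw [hpre] at h
  exact h

theorem _root_.Continuous.integrableOn_ball {n : ℕ} {F : CSpace n → ℂ} (hF : Continuous F)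
    (c : CSpace n) (r : ℝ) : IntegrableOn F (Metric.ball c r) :=
  (hF.continuousOn.integrableOn_compact (isCompact_closedBall c r)).mono_set
    Metric.ball_subset_closedBall

/-- On each complex line through `0` the circle mean of `G` is `G 0 = 0`. The ball is invariant
under the rotations `z ↦ e^{iθ} z`, so Fubini identifies `2π` times the integral with the integral
of these means. -/
theorem setIntegral_ball_eq_zero_of_entire {n : ℕ} (r : ℝ) {G : CSpace n → ℂ}
    (hG : Differentiable ℂ G) (h0 : G 0 = 0) :
    ∫ z in Metric.ball (0 : CSpace n) r, G z = 0 := by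
  have hpi : (0 : ℝ) < 2 * Real.pi := by positivity
  have hcirc : ∀ z, ∫ θ in Set.Ioc 0 (2 * Real.pi), G (circleMap 0 1 θ • z) = 0 := by
    intro z
    have h1 := DiffContOnCl.circleAverage (f := fun t : ℂ => G (t • z)) (c := 0) (R := 1)
      (by fun_prop : Differentiable ℂ fun t : ℂ => G (t • z)).diffContOnCl
    rw [Real.circleAverage_def, intervalIntegral.integral_of_le hpi.le, zero_smul, h0] at h1
    exact (smul_eq_zero.1 h1).resolve_left (by positivity)
  have hint : Integrable (Function.uncurry fun (θ : ℝ) (z : CSpace n) => G (circleMap 0 1 θ • z))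
      ((volume.restrict (Set.Ioc 0 (2 * Real.pi))).prod
        (volume.restrict (Metric.ball (0 : CSpace n) r))) := by
    rw [Measure.prod_restrict]
    have hc : Continuous (Function.uncurry fun (θ : ℝ) (z : CSpace n) =>
        G (circleMap 0 1 θ • z)) :=
      hG.continuous.comp (((continuous_circleMap 0 1).comp continuous_fst).smul continuous_snd)
    exact (hc.continuousOn.integrableOn_compact
      ((isCompact_Icc (a := (0 : ℝ)) (b := 2 * Real.pi)).prod
        (isCompact_closedBall (0 : CSpace n) r))).mono_set
      (Set.prod_mono Set.Ioc_subset_Icc_self Metric.ball_subset_closedBall)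
  have h := integral_integral_swap hint
  simp only [hcirc, integral_zero,
    fun θ => setIntegral_ball_smul_of_norm_eq_one r (t := circleMap 0 1 θ) (by simp) G] at h
  simp only [integral_const, MeasurableSet.univ, measureReal_restrict_apply, Set.univ_inter,
    Real.volume_real_Ioc, smul_eq_zero] at h
  refine h.resolve_left ?_
  rw [sub_zero, max_eq_left hpi.le]
  exact hpi.ne'

theorem setIntegral_ball_eq_translate {n : ℕ} (w : CSpace n) (r : ℝ) (F : CSpace n → ℂ) :
    ∫ z in Metric.ball w r, F z = ∫ z in Metric.ball (0 : CSpace n) r, F (w + z) := by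
  have h := (measurePreserving_add_left (volume : Measure (CSpace n)) w).setIntegral_preimage_emb
    (MeasurableEquiv.addLeft w).measurableEmbedding F (Metric.ball w r)
  rw [← h]
  congr 3
  ext z
  simp

theorem exists_complexLinear_of_map_I_smul {E : Type*} [NormedAddCommGroup E] [NormedSpace ℂ E]
    (A : E →L[ℝ] ℂ) (h : ∀ z, A (Complex.I • z) = Complex.I * A z) :
    ∃ L : E →L[ℂ] ℂ, L.restrictScalars ℝ = A := by
  refine ⟨⟨⟨⟨A, A.map_add⟩, fun c z => ?_⟩, A.continuous⟩, rfl⟩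
  change A (c • z) = c * A z
  have hc : c • z = c.re • z + c.im • (Complex.I • z) := by
    conv_lhs => rw [← Complex.re_add_im c]
    rw [add_smul, mul_smul, Complex.coe_smul, Complex.coe_smul]
  rw [hc, map_add, map_smul, map_smul, h, Complex.real_smul, Complex.real_smul]
  conv_rhs => rw [← Complex.re_add_im c]
  ring

-- A blow-up at `w`: scaling the ball of radius `s` to the unit ball turns the moment of `f - f w`
-- into one of the difference quotient `(f(w + s z) - f w) / s`, and dominated convergence lets `s →
-- 0`. The constant `f w` costs nothing, since `l` itself has mean zero over balls.
open scoped Pointwise in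
theorem setIntegral_unitBall_fderiv_mul_eq_zero {n : ℕ} {f : CSpace n → ℂ} (hfc : Continuous f)
    {w : CSpace n} (hf : DifferentiableAt ℝ f w) (l : CSpace n →L[ℂ] ℂ)
    (h : ∀ r : ℝ, 0 < r → r ≤ 1 → ∫ z in Metric.ball (0 : CSpace n) r, f (w + z) * l z = 0) :
    ∫ z in Metric.ball (0 : CSpace n) 1, fderiv ℝ f w z * l z = 0 := by
  set A := fderiv ℝ f w
  set s : ℕ → ℝ := fun k => 1 / ((k : ℝ) + 1)
  have hs0 : ∀ k, 0 < s k := fun k => by simp only [s]; positivity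
  have hs1 : ∀ k, s k ≤ 1 := fun k => by
    simp only [s]; rw [div_le_one (by positivity)]; simp
  have hs : Tendsto s atTop (𝓝 0) := tendsto_one_div_add_atTop_nhds_zero_nat
  have hl0 : ∀ r, ∫ z in Metric.ball (0 : CSpace n) r, f w * l z = 0 := fun r =>
    setIntegral_ball_eq_zero_of_entire r (by fun_prop) (by simp)
  have hz : ∀ k, ∫ z in Metric.ball (0 : CSpace n) 1,
      (((s k)⁻¹ : ℝ) : ℂ) * (f (w + s k • z) - f w) * l z = 0 := by
    intro k
    have h1 := Measure.setIntegral_comp_smul (volume : Measure (CSpace n))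
      (fun z => (f (w + z) - f w) * l z) (Metric.ball 0 1) (hs0 k).ne'
    have h2 : ∫ z in s k • Metric.ball (0 : CSpace n) 1, (f (w + z) - f w) * l z = 0 := by
      rw [smul_ball (hs0 k).ne', smul_zero, mul_one, Real.norm_of_nonneg (hs0 k).le]
      simp only [sub_mul]
      rw [integral_sub (Continuous.integrableOn_ball (by fun_prop) _ _)
        (Continuous.integrableOn_ball (by fun_prop) _ _), h _ (hs0 k) (hs1 k), hl0, sub_zero]
    rw [h2, smul_zero] at h1
    -- One factor `s⁻¹` belongs to the difference quotient, the other compensates `l (s z) = s l z`.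
    have h3 : ∀ z, (((s k)⁻¹ : ℝ) : ℂ) * (f (w + s k • z) - f w) * l z =
        ((((s k)⁻¹) ^ 2 : ℝ) : ℂ) * ((f (w + s k • z) - f w) * l (s k • z)) := by
      intro z
      have : ((s k : ℝ) : ℂ) ≠ 0 := by exact_mod_cast (hs0 k).ne'
      have h4 : l (s k • z) = ((s k : ℝ) : ℂ) * l z := by
        rw [← Complex.coe_smul, map_smul, smul_eq_mul]
      rw [h4]; push_cast; field_simp
    simp only [h3]
    rw [integral_const_mul, h1, mul_zero]
  have hfd := hf.hasFDerivAt
  have hlim : ∀ z, Tendsto (fun k => (((s k)⁻¹ : ℝ) : ℂ) * (f (w + s k • z) - f w) * l z) atTop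
      (𝓝 (A z * l z)) := by
    intro z
    refine Tendsto.mul_const _ ?_
    have hsp : Tendsto s atTop (𝓝[>] 0) :=
      tendsto_nhdsWithin_iff.2 ⟨hs, Eventually.of_forall hs0⟩
    have h1 := hfd.lim z (l := atTop) (c := fun k => (s k)⁻¹)
      (tendsto_norm_atTop_atTop.comp (tendsto_inv_nhdsGT_zero.comp hsp))
    simpa only [Complex.real_smul, inv_inv] using h1
  -- Differentiability at `w` alone gives a local linear bound there, which supplies the dominating
  -- function for small `s`.
  obtain ⟨δ, hδ, hb⟩ : ∃ δ > 0, ∀ v : CSpace n, ‖v‖ < δ →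
      ‖f (w + v) - f w‖ ≤ (‖A‖ + 1) * ‖v‖ := by
    have h1 := hfd.isLittleO.def zero_lt_one
    obtain ⟨δ, hδ, h2⟩ := Metric.eventually_nhds_iff.1 h1
    refine ⟨δ, hδ, fun v hv => ?_⟩
    have h3 := h2 (y := w + v) (by simpa using hv)
    simp only [add_sub_cancel_left, one_mul] at h3
    have h4 := A.le_opNorm v
    have h5 := norm_add_le (f (w + v) - f w - A v) (A v)
    rw [sub_add_cancel] at h5
    linarith
  refine (tendsto_nhds_unique (tendsto_const_nhds.congr fun k => (hz k).symm)
    (tendsto_integral_filter_of_dominated_convergence (fun z => (‖A‖ + 1) * ‖l z‖) ?_ ?_ ?_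
      (ae_of_all _ hlim))).symm
  · exact Eventually.of_forall fun k => Continuous.aestronglyMeasurable (by fun_prop)
  · filter_upwards [hs.eventually (gt_mem_nhds hδ)] with k hk
    filter_upwards [ae_restrict_mem Metric.isOpen_ball.measurableSet] with z hz
    have hz1 : ‖z‖ < 1 := by simpa using hz
    have h1 : ‖s k • z‖ ≤ s k := by
      rw [norm_smul, Real.norm_of_nonneg (hs0 k).le]
      exact mul_le_of_le_one_right (hs0 k).le hz1.le
    rw [norm_mul, norm_mul, Complex.norm_real, Real.norm_of_nonneg (inv_nonneg.2 (hs0 k).le)]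
    gcongr
    rw [inv_mul_le_iff₀ (hs0 k), mul_comm]
    exact (hb _ (h1.trans_lt hk)).trans (by gcongr)
  · exact (Continuous.integrableOn_ball (F := fun z => (((‖A‖ + 1) * ‖l z‖ : ℝ) : ℂ))
      (by fun_prop) 0 1).re

/-- A Cauchy–Riemann criterion: `f` is complex differentiable at `w` as soon as its moments against
complex linear forms over small balls around `w` vanish. -/
theorem differentiableAt_complex_of_setIntegral_eq_zero {n : ℕ} {f : CSpace n → ℂ}
    (hfc : Continuous f) {w : CSpace n} (hf : DifferentiableAt ℝ f w)
    (h : ∀ (l : CSpace n →L[ℂ] ℂ) (r : ℝ), 0 < r → r ≤ 1 →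
      ∫ z in Metric.ball (0 : CSpace n) r, f (w + z) * l z = 0) : DifferentiableAt ℂ f w := by
  set A := fderiv ℝ f w
  have hA : ∀ l : CSpace n →L[ℂ] ℂ, ∫ z in Metric.ball (0 : CSpace n) 1, A z * l z = 0 :=
    fun l => setIntegral_unitBall_fderiv_mul_eq_zero hfc hf l (h l)
  let J : CSpace n →L[ℝ] CSpace n :=
    (Complex.I • ContinuousLinearMap.id ℂ (CSpace n)).restrictScalars ℝ
  have hII : ∀ z : CSpace n, Complex.I • Complex.I • z = -z := fun z => by
    rw [smul_smul, Complex.I_mul_I, neg_one_smul]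
  -- `D` is twice the conjugate-linear part of `A`; its vanishing is the Cauchy–Riemann system.
  let D : CSpace n →L[ℝ] ℂ := A + Complex.I • (A.comp J)
  have hD : ∀ z, D z = A z + Complex.I * A (Complex.I • z) := fun z => rfl
  have hDI : ∀ z, D (Complex.I • z) = -(Complex.I * D z) := fun z => by
    rw [hD, hD, hII, map_neg]
    linear_combination A (Complex.I • z) * Complex.I_mul_I
  -- The conjugate of `D` is complex linear, hence an admissible test form, and it makes the
  -- integrand `D z * l z` equal to `|D z|²`.
  obtain ⟨l, hl⟩ := exists_complexLinear_of_map_I_smul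
    ((Complex.conjCLE : ℂ →L[ℝ] ℂ).comp D) (fun z => by simp [hDI])
  have hlD : ∀ z, l z = starRingEnd ℂ (D z) := fun z => DFunLike.congr_fun hl z
  -- Substitute `z ↦ i z`, which preserves the ball, and use `l (i z) = i l z`.
  have hAI : ∫ z in Metric.ball (0 : CSpace n) 1, A (Complex.I • z) * l z = 0 := by
    have h1 := (setIntegral_ball_smul_of_norm_eq_one 1 Complex.norm_I
      (fun z => -Complex.I * (A z * l z))).trans (by rw [integral_const_mul, hA, mul_zero])
    refine (integral_congr_ae (ae_of_all _ fun z => ?_)).trans h1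
    simp only [l.map_smul, smul_eq_mul]
    linear_combination A (Complex.I • z) * l z * Complex.I_mul_I
  have hDl : ∫ z in Metric.ball (0 : CSpace n) 1, D z * l z = 0 := by
    simp only [hD, add_mul, mul_assoc]
    rw [integral_add (Continuous.integrableOn_ball (by fun_prop) _ _)
      (Continuous.integrableOn_ball (by fun_prop) _ _), integral_const_mul, hA, hAI]
    simp
  have hsq : ∫ z in Metric.ball (0 : CSpace n) 1, ‖D z‖ ^ 2 = 0 := by
    have h1 : ∀ z, D z * l z = ((‖D z‖ ^ 2 : ℝ) : ℂ) := fun z => by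
      rw [hlD, Complex.mul_conj, Complex.normSq_eq_norm_sq]
    simp only [h1] at hDl
    rw [integral_complex_ofReal] at hDl
    exact_mod_cast hDl
  have hae : (fun z => ‖D z‖ ^ 2) =ᵐ[volume.restrict (Metric.ball (0 : CSpace n) 1)] 0 := by
    refine (integral_eq_zero_iff_of_nonneg (fun z => by positivity) ?_).1 hsq
    exact (Continuous.integrableOn_ball (F := fun z => ((‖D z‖ ^ 2 : ℝ) : ℂ))
      (by fun_prop) 0 1).re
  have hball := Measure.eqOn_open_of_ae_eq hae Metric.isOpen_ball (by fun_prop) (by fun_prop)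
  have hD0 : ∀ z, D z = 0 := by
    -- `D` vanishes on the unit ball; real homogeneity extends this to every `z`.
    intro z
    have hp : 0 < ‖z‖ + 1 := by positivity
    have h1 := hball (x := (‖z‖ + 1)⁻¹ • z) (by
      rw [mem_ball_zero_iff, norm_smul, norm_inv, Real.norm_of_nonneg hp.le,
        inv_mul_lt_iff₀ hp]
      linarith)
    simp only [map_smul, Pi.zero_apply, ne_eq, OfNat.ofNat_ne_zero, not_false_eq_true,
      pow_eq_zero_iff, norm_eq_zero] at h1
    exact (smul_eq_zero.1 h1).resolve_left (inv_ne_zero hp.ne')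
  obtain ⟨L, hL⟩ := exists_complexLinear_of_map_I_smul A fun z => by
    have := hD0 z
    rw [hD] at this
    linear_combination (-Complex.I) * this + A (Complex.I • z) * Complex.I_mul_I
  exact (hasFDerivAt_of_restrictScalars ℝ hf.hasFDerivAt hL).differentiableAt

/-! ### Behaviour at infinity: polynomials, moment functionals, coherent states -/

/-- A nonconstant polynomial blows up at infinity, and a constant with limit `0` is `0`. -/
theorem _root_.Polynomial.eq_zero_of_tendsto_zero {P : Polynomial ℂ} {s : ℕ → ℂ}
    (hs : Tendsto (fun k => ‖s k‖) atTop atTop)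
    (h : Tendsto (fun k => P.eval (s k)) atTop (𝓝 0)) : P = 0 := by
  rcases lt_or_ge 0 P.degree with hd | hd
  · exact absurd h.norm (not_tendsto_nhds_of_tendsto_atTop (P.tendsto_norm_atTop hd hs) _)
  · rw [Polynomial.eq_C_of_degree_le_zero hd] at h ⊢
    simp only [Polynomial.eval_C] at h
    rw [tendsto_nhds_unique tendsto_const_nhds h, map_zero]

/-- Local moments near `w` of `u / g_w`, `g_w` the coherent state, are bounded functionals of
`u ∈ L²_m`, uniformly in `w`. -/
theorem exists_momentFunctional (n m : ℕ) [NeZero n] (l : CSpace n →L[ℂ] ℂ) {r : ℝ}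
    (hr : r ≤ 1) : ∃ C : ℝ, 0 ≤ C ∧ ∀ w : CSpace n, 2 ≤ ‖w‖ → ∃ φ : L2Space n m →L[ℂ] ℂ, ‖φ‖ ≤ C ∧
      ∀ (u : L2Space n m) (F : CSpace n → ℂ), u =ᵐ[fockSobolevMeasure n m] F →
        φ u = ∫ z in Metric.ball w r, F z / coherent m w z * l (z - w) := by
  have hω := omega_pos n m
  -- On the ball `e^{-|z - w|²} ≥ e^{-1}` and `|z| ≥ |w| / 2`, so `|g_w|²` times the density is at
  -- least `ω / (e 2^{2m})`; `K` is `‖l‖²` divided by this lower bound.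
  set K : ℝ := ‖l‖ ^ 2 * (Real.exp 1 * 2 ^ (2 * m)) / omega n m with hK
  have hK0 : 0 ≤ K := by positivity
  set I : ℝ := K * (volume (Metric.ball (0 : CSpace n) r)).toReal with hI
  refine ⟨I + 1, by positivity, fun w hw => ?_⟩
  have hw0 : w ≠ 0 := fun h => by norm_num [h] at hw
  set ρ : CSpace n → ℝ := fun z => omega n m * ‖z‖ ^ (2 * m) * Real.exp (-‖z‖ ^ 2) with hρ
  have hρ0 : ∀ z, 0 ≤ ρ z := fun z => by simp only [hρ]; positivity
  -- Here `|w| ≥ 2` and `r ≤ 1` matter: they keep the ball away from the origin, where the density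
  -- may vanish.
  have hzB : ∀ z ∈ Metric.ball w r, ‖z - w‖ ≤ 1 ∧ ‖w‖ ≤ 2 * ‖z‖ := by
    intro z hz
    have h1 : ‖z - w‖ ≤ 1 := by
      have := (mem_ball_iff_norm.1 hz).le
      linarith
    have h2 : ‖w‖ ≤ ‖z‖ + ‖z - w‖ := by
      have := norm_sub_le z (z - w); simpa using this
    exact ⟨h1, by linarith⟩
  have hρB : ∀ z ∈ Metric.ball w r, 0 < ρ z := by
    intro z hz
    have := (hzB z hz).2
    have : 0 < ‖z‖ := by linarith
    simp only [hρ]; positivity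
  -- Division by the density `ρ` turns the pairing in `L²_m` into a Lebesgue integral over the ball;
  -- `star χ` is the Riesz representative of the functional.
  set χ : CSpace n → ℂ := (Metric.ball w r).indicator fun z =>
    l (z - w) / (coherent m w z * (ρ z : ℂ)) with hχ
  have hχm : Measurable χ := by
    refine Measurable.indicator ?_ Metric.isOpen_ball.measurableSet
    have h1 := (continuous_coherent m w).measurable
    have h2 : Measurable ρ := by simp only [hρ]; fun_prop
    have h3 : Measurable fun z => l (z - w) := Continuous.measurable (by fun_prop)
    fun_prop
  have hsq : eLpNorm (fun z => star (χ z)) 2 (fockSobolevMeasure n m) ^ 2 ≤ ENNReal.ofReal I := by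
    have hrw : ENNReal.ofReal I = ∫⁻ z, (Metric.ball w r).indicator (fun _ => ENNReal.ofReal K) z := by
      rw [lintegral_indicator Metric.isOpen_ball.measurableSet, lintegral_const,
        Measure.restrict_apply_univ, hI, ENNReal.ofReal_mul hK0,
        ENNReal.ofReal_toReal measure_ball_lt_top.ne, Measure.addHaar_ball_center _ w]
    rw [eLpNorm_two_sq, lintegral_fockSobolevMeasure, hrw]
    refine lintegral_mono fun z => ?_
    by_cases hz : z ∈ Metric.ball w r
    · rw [Set.indicator_of_mem hz]
      refine ENNReal.ofReal_le_ofReal ?_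
      simp only [hχ, Set.indicator_of_mem hz, norm_star, norm_div, norm_mul, Complex.norm_real,
        Real.norm_of_nonneg (hρ0 z)]
      obtain ⟨h1, h2⟩ := hzB z hz
      have hρz := hρB z hz
      change ρ z * _ ≤ K
      have hg := coherent_ne_zero m hw0 z
      have hlow : omega n m / (Real.exp 1 * 2 ^ (2 * m)) ≤ ‖coherent m w z‖ ^ 2 * ρ z := by
        rw [norm_coherent_sq]
        have h3 : Real.exp (‖z‖ ^ 2) * Real.exp (-‖z‖ ^ 2) = 1 := by
          rw [← Real.exp_add]; simp
        have h4 : Real.exp (-1) ≤ Real.exp (-‖z - w‖ ^ 2) := by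
          apply Real.exp_le_exp.2
          nlinarith [norm_nonneg (z - w)]
        have h5 : (1 / 2) ^ (2 * m) ≤ ‖z‖ ^ (2 * m) / ‖w‖ ^ (2 * m) := by
          rw [← div_pow]
          refine pow_le_pow_left₀ (by norm_num) ?_ _
          rw [div_le_div_iff₀ (by norm_num) (by linarith)]
          linarith
        calc _ = omega n m * Real.exp (-1) * (1 / 2) ^ (2 * m) := by
              rw [Real.exp_neg, div_pow, one_pow]; field_simp
          _ ≤ omega n m * Real.exp (-‖z - w‖ ^ 2) * (‖z‖ ^ (2 * m) / ‖w‖ ^ (2 * m)) := by gcongr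
          _ = omega n m * Real.exp (-‖z - w‖ ^ 2) * (‖z‖ ^ (2 * m) / ‖w‖ ^ (2 * m)) *
              (Real.exp (‖z‖ ^ 2) * Real.exp (-‖z‖ ^ 2)) := by rw [h3, mul_one]
          _ = _ := by simp only [hρ]; ring
      have hl : ‖l (z - w)‖ ≤ ‖l‖ := by
        have := l.le_opNorm (z - w)
        exact this.trans (mul_le_of_le_one_right (norm_nonneg _) h1)
      have hgp : 0 < ‖coherent m w z‖ := norm_pos_iff.2 hg
      calc ρ z * (‖l (z - w)‖ / (‖coherent m w z‖ * ρ z)) ^ 2 =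
          ‖l (z - w)‖ ^ 2 / (‖coherent m w z‖ ^ 2 * ρ z) := by field_simp
        _ ≤ ‖l‖ ^ 2 / (omega n m / (Real.exp 1 * 2 ^ (2 * m))) := by gcongr
        _ = K := by rw [hK]; field_simp
    · simp [hχ, Set.indicator_of_notMem hz]
  have hmem : MemLp (fun z => star (χ z)) 2 (fockSobolevMeasure n m) := by
    refine ⟨(continuous_star.measurable.comp hχm).aestronglyMeasurable, ?_⟩
    exact (ENNReal.pow_lt_top_iff.1 (hsq.trans_lt ENNReal.ofReal_lt_top)).resolve_right two_ne_zero
  refine ⟨innerSL ℂ (hmem.toLp _), ?_, fun u F huF => ?_⟩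
  · rw [innerSL_apply_norm, Lp.norm_toLp]
    have h1 := ENNReal.toReal_mono ENNReal.ofReal_ne_top hsq
    rw [ENNReal.toReal_pow, ENNReal.toReal_ofReal (by positivity)] at h1
    have hI0 : 0 ≤ I := by positivity
    -- From `x² ≤ I` one gets `x ≤ (x² + 1) / 2 ≤ I + 1`.
    nlinarith [sq_nonneg ((eLpNorm (fun z => star (χ z)) 2 (fockSobolevMeasure n m)).toReal - 1)]
  · rw [innerSL_apply_apply, L2.inner_def, ← integral_indicator Metric.isOpen_ball.measurableSet]
    have h1 : (fun z => inner ℂ ((hmem.toLp _ : L2Space n m) z) (u z)) =ᵐ[fockSobolevMeasure n m]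
        fun z => F z * χ z := by
      filter_upwards [huF, hmem.coeFn_toLp] with z hz1 hz2
      rw [hz1, hz2]
      simp
    rw [integral_congr_ae h1, fockSobolevMeasure,
      integral_withDensity_eq_integral_toReal_smul (by fun_prop) (by simp)]
    congr 1
    ext z
    rw [ENNReal.toReal_ofReal (hρ0 z)]
    by_cases hz : z ∈ Metric.ball w r
    · have h2 : (ρ z : ℂ) ≠ 0 := by exact_mod_cast (hρB z hz).ne'
      have hg := coherent_ne_zero m hw0 z
      simp only [hχ, Set.indicator_of_mem hz, Complex.real_smul]
      change (ρ z : ℂ) * _ = _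
      field_simp
    · simp [hχ, Set.indicator_of_notMem hz]

/-- The coherent state has no zeros, so the integrand is entire, and `l (z - w)` makes it vanish at
the centre. This is why the moment functionals ignore the projected part `P_m (f g)`. -/
theorem setIntegral_div_coherent_eq_zero {n : ℕ} (m : ℕ) (l : CSpace n →L[ℂ] ℂ) (r : ℝ)
    {w : CSpace n} (hw : w ≠ 0) {h : CSpace n → ℂ} (hh : Differentiable ℂ h) :
    ∫ z in Metric.ball w r, h z / coherent m w z * l (z - w) = 0 := by
  rw [setIntegral_ball_eq_translate]
  refine setIntegral_ball_eq_zero_of_entire r ?_ (by simp)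
  have h1 := differentiable_coherent m w
  have h2 := coherent_ne_zero m hw
  simp only [add_sub_cancel_left, div_eq_mul_inv]
  refine Differentiable.mul (Differentiable.mul (by fun_prop) ?_) (by fun_prop)
  exact Differentiable.inv (by fun_prop) fun z => h2 _

/-- For fixed `z`, `|g_v(z)|² ≤ e^{|z|²} e^{-|z - v|²}` tends to `0` as `|v| → ∞`, and `|g_v(z)| ≤
e^{|z|²}` dominates on the ball. -/
theorem tendsto_setIntegral_coherent {n : ℕ} (m : ℕ) (l : CSpace n →L[ℂ] ℂ) (r : ℝ)
    {w : CSpace n} (hw : w ≠ 0) {f : CSpace n → ℂ} (hf : Continuous f) {v : ℕ → CSpace n}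
    (hv : Tendsto (fun k => ‖v k‖) atTop atTop) :
    Tendsto (fun k => ∫ z in Metric.ball w r, f z * coherent m (v k) z / coherent m w z * l (z - w))
      atTop (𝓝 0) := by
  have hg := coherent_ne_zero m hw
  have hgc := continuous_coherent m w
  set F : CSpace n → ℂ := fun z => f z / coherent m w z * l (z - w) with hF
  have hFc : Continuous F := (hf.div hgc hg).mul (by fun_prop)
  have hsq : ∀ k z, 1 ≤ ‖v k‖ → ‖coherent m (v k) z‖ ^ 2 ≤
      Real.exp (‖z‖ ^ 2) * Real.exp (-‖z - v k‖ ^ 2) := by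
    intro k z hk
    rw [norm_coherent_sq]
    exact div_le_self (by positivity) (one_le_pow₀ hk)
  have hcoh : ∀ z, Tendsto (fun k => coherent m (v k) z) atTop (𝓝 0) := by
    intro z
    have h1 : Tendsto (fun k => ‖z - v k‖) atTop atTop := by
      refine tendsto_atTop_mono (fun k => ?_) (tendsto_atTop_add_const_right _ (-‖z‖) hv)
      have := norm_sub_norm_le (v k) z
      rw [norm_sub_rev z]
      linarith
    have h2 : Tendsto (fun k => Real.exp (‖z‖ ^ 2) * Real.exp (-‖z - v k‖ ^ 2)) atTop (𝓝 0) := by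
      have := (Real.tendsto_exp_neg_atTop_nhds_zero.comp
        ((tendsto_pow_atTop two_ne_zero).comp h1)).const_mul (Real.exp (‖z‖ ^ 2))
      simpa using this
    have h3 : Tendsto (fun k => ‖coherent m (v k) z‖ ^ 2) atTop (𝓝 0) := by
      refine squeeze_zero' (Eventually.of_forall fun k => by positivity) ?_ h2
      filter_upwards [hv.eventually_ge_atTop 1] with k hk using hsq k z hk
    have h4 := h3.sqrt
    simp only [Real.sqrt_sq (norm_nonneg _), Real.sqrt_zero] at h4
    exact tendsto_zero_iff_norm_tendsto_zero.2 h4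
  have hrw : ∀ k z, f z * coherent m (v k) z / coherent m w z * l (z - w) =
      F z * coherent m (v k) z := fun k z => by simp only [hF]; ring
  simp only [hrw]
  have h0 : (0 : ℂ) = ∫ z in Metric.ball w r, (0 : ℂ) := by simp
  rw [h0]
  refine tendsto_integral_filter_of_dominated_convergence
    (fun z => ‖F z‖ * Real.exp (‖z‖ ^ 2)) ?_ ?_ ?_ (ae_of_all _ fun z => ?_)
  · exact Eventually.of_forall fun k =>
      (hFc.mul (continuous_coherent m (v k))).aestronglyMeasurable
  · filter_upwards [hv.eventually_ge_atTop 1] with k hk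
    refine ae_of_all _ fun z => ?_
    rw [norm_mul]
    gcongr
    refine le_of_sq_le_sq ?_ (Real.exp_pos _).le
    refine (hsq k z hk).trans ?_
    rw [sq (Real.exp _)]
    gcongr
    nlinarith [sq_nonneg ‖z‖, sq_nonneg ‖z - v k‖]
  · exact (Continuous.integrableOn_ball (F := fun z => ((‖F z‖ * Real.exp (‖z‖ ^ 2) : ℝ) : ℂ))
      (by fun_prop) w r).re
  · simpa using (hcoh z).const_mul (F z)

/-! ### The Hankel operator on coherent states and the two implications -/

/-- Evaluation of the Hankel operator at coherent states by local moments. -/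
theorem exists_coherent_hankel (n m : ℕ) [NeZero n] (p : MvPolynomial (Fin n ⊕ Fin n) ℂ)
    {v : CSpace n} (hv : 1 ≤ ‖v‖) {T : fockSobolev n m →L[ℂ] L2Space n m}
    (hT : ∀ g : (hankel n m (polySymbol p)).domain, T g = hankel n m (polySymbol p) g) :
    ∃ G : fockSobolev n m, (G : L2Space n m) =ᵐ[fockSobolevMeasure n m] coherent m v ∧
      ∃ h : CSpace n → ℂ, Differentiable ℂ h ∧
        T G =ᵐ[fockSobolevMeasure n m] fun z => polySymbol p z * coherent m v z - h z := by
  have hmem : MemLp (coherent m v) 2 (fockSobolevMeasure n m) := by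
    have := memLp_mul_coherent n m hv (F := fun _ => 1) continuous_const (C := 1) (N := 0) (by simp)
    simpa using this
  let G : fockSobolev n m := ⟨hmem.toLp _, coherent m v,
    IsFockSobolev.of_memLp (differentiable_coherent m v) hmem, hmem.coeFn_toLp⟩
  have hG : (G : L2Space n m) =ᵐ[fockSobolevMeasure n m] coherent m v := hmem.coeFn_toLp
  obtain ⟨C, N, hCN⟩ := exists_polySymbol_bound p
  -- Polynomial growth of the symbol puts the coherent state in the domain, where `T` is known to
  -- agree with the Hankel operator.
  have hfg : MemLp (fun z => polySymbol p z * (G : L2Space n m) z) 2 (fockSobolevMeasure n m) := by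
    refine (memLp_congr_ae ?_).2 (memLp_mul_coherent n m hv (continuous_polySymbol p) hCN)
    filter_upwards [hG] with z hz
    rw [hz]
  refine ⟨G, hG, ?_⟩
  have hTG := hT ⟨G, hfg⟩
  obtain ⟨h, hh, hPh⟩ := (fockSobolev n m).starProjection_apply_mem (hfg.toLp _)
  refine ⟨h, hh.entire, ?_⟩
  have h2 : T G = hfg.toLp _ - (fockSobolev n m).starProjection (hfg.toLp _) := hTG
  rw [h2]
  filter_upwards [Lp.coeFn_sub (hfg.toLp _) ((fockSobolev n m).starProjection (hfg.toLp _)), hPh,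
    hfg.coeFn_toLp, hG] with z h3 h4 h5 h6
  rw [h3, Pi.sub_apply, h4, h5, h6]

theorem hankelCompact_of_differentiable (n m : ℕ) [NeZero n] {f : CSpace n → ℂ}
    (hf : Differentiable ℂ f) : HankelCompact n m f := by
  refine ⟨0, isCompactOperator_zero, fun g => ?_⟩
  have hfg : MemLp (fun z => f z * g.1.1 z) 2 (fockSobolevMeasure n m) := g.2
  obtain ⟨k, hk, hgk⟩ := g.1.2
  have hae : (fun z => f z * g.1.1 z) =ᵐ[fockSobolevMeasure n m] fun z => f z * k z := by
    filter_upwards [hgk] with z hz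
    rw [hz]
  have hmem : hfg.toLp _ ∈ fockSobolev n m :=
    ⟨fun z => f z * k z, IsFockSobolev.of_memLp (hf.mul hk.entire) ((memLp_congr_ae hae).1 hfg),
      hfg.coeFn_toLp.trans hae⟩
  have h1 : hankel n m f g = hfg.toLp _ - (fockSobolev n m).starProjection (hfg.toLp _) := rfl
  rw [h1, Submodule.starProjection_eq_self_iff.2 hmem, sub_self]
  rfl

/-- Compactness makes the moments of the symbol small along a sequence going to infinity on a line
through `w`; polynomiality in the line parameter transports the vanishing back to `w`. -/
theorem setIntegral_polySymbol_mul_eq_zero (n m : ℕ) [NeZero n]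
    (p : MvPolynomial (Fin n ⊕ Fin n) ℂ) (hc : HankelCompact n m (polySymbol p))
    (l : CSpace n →L[ℂ] ℂ) {r : ℝ} (hr : r ≤ 1) (w : CSpace n) :
    ∫ z in Metric.ball (0 : CSpace n) r, polySymbol p (w + z) * l z = 0 := by
  obtain ⟨T, hTc, hT⟩ := hc
  set f : CSpace n → ℂ := polySymbol p
  have hf : Continuous f := continuous_polySymbol p
  set e : CSpace n := EuclideanSpace.single 0 1 with he
  have he1 : ‖e‖ = 1 := by simp [he]
  -- The shift by `‖w‖ + 2` ensures `‖v k‖ ≥ k + 2`, so both the coherent state bounds and the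
  -- moment functionals apply from `k = 0` on.
  set s : ℕ → ℝ := fun k => (k : ℝ) + ‖w‖ + 2 with hs
  set v : ℕ → CSpace n := fun k => w + (s k : ℂ) • e with hv
  have hvk : ∀ k : ℕ, (k : ℝ) + 2 ≤ ‖v k‖ := by
    intro k
    have h1 : ‖(s k : ℂ) • e‖ = s k := by
      rw [norm_smul, he1, mul_one, Complex.norm_real, Real.norm_of_nonneg]
      simp only [hs]; positivity
    have h2 := norm_sub_le (v k) w
    simp only [hv, add_sub_cancel_left, h1] at h2
    simp only [hv]
    simp only [hs] at h2 ⊢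
    linarith
  have hv2 : ∀ k, 2 ≤ ‖v k‖ := fun k => by
    have := hvk k
    have : (0 : ℝ) ≤ k := Nat.cast_nonneg k
    linarith
  have hv0 : ∀ k, v k ≠ 0 := fun k h => by
    have := hv2 k
    norm_num [h] at this
  have hvt : Tendsto (fun k => ‖v k‖) atTop atTop :=
    tendsto_atTop_mono (fun k => (by linarith [hvk k] : (k : ℝ) ≤ ‖v k‖))
      tendsto_natCast_atTop_atTop
  choose G hG h hh hTG using fun k =>
    exists_coherent_hankel n m p (v := v k) (by linarith [hv2 k]) hT
  obtain ⟨B, hB⟩ := exists_eLpNorm_coherent_le n m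
  -- `B` is not known to be nonnegative, hence the maximum with `0`.
  have hGB : ∀ k, ‖G k‖ ≤ max B 0 := by
    intro k
    change ‖(G k : L2Space n m)‖ ≤ _
    rw [Lp.norm_def, eLpNorm_congr_ae (hG k)]
    have := ENNReal.toReal_mono ENNReal.ofReal_ne_top (hB (v k) (by linarith [hv2 k]))
    rwa [ENNReal.toReal_ofReal'] at this
  obtain ⟨y, -, κ, hκ, hy⟩ := (hTc.isCompact_closure_image_closedBall (max B 0)).tendsto_subseq
    (x := fun k => T (G k)) fun k => subset_closure ⟨G k, by simpa using hGB k, rfl⟩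
  obtain ⟨C, hC0, hC⟩ := exists_momentFunctional n m l hr
  choose φ hφC hφ using fun k => hC (v k) (hv2 k)
  have hφT : ∀ k j, φ k (T (G j)) =
      ∫ z in Metric.ball (v k) r, f z * coherent m (v j) z / coherent m (v k) z * l (z - v k) := by
    intro k j
    have hg := coherent_ne_zero m (hv0 k)
    have hgc := continuous_coherent m (v k)
    have hgj := continuous_coherent m (v j)
    rw [hφ k _ _ (hTG j)]
    simp only [sub_div, sub_mul]
    rw [integral_sub (Continuous.integrableOn_ball ?_ _ _) (Continuous.integrableOn_ball ?_ _ _),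
      setIntegral_div_coherent_eq_zero m l r (hv0 k) (hh j), sub_zero]
    · exact ((hf.mul hgj).div hgc hg).mul (by fun_prop)
    -- The subtracted term is integrable because `h j` is continuous and the coherent state has no
    -- zeros.
    · exact ((hh j).continuous.div hgc hg).mul (by fun_prop)
  have hφy : ∀ k, φ k y = 0 := by
    intro k
    have h1 := ((φ k).continuous.tendsto y).comp hy
    refine tendsto_nhds_unique h1 ?_
    have h2 := (tendsto_setIntegral_coherent m l r (hv0 k) hf hvt).comp hκ.tendsto_atTop
    refine h2.congr fun j => ?_
    exact (hφT k (κ j)).symm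
  -- Since `φ (κ k)` kills `y`, its value at `T (G (κ k))` is its value at the difference from `y`.
  -- The bound `C`, uniform in `k`, is essential because the functional moves with the vector.
  have hlim : Tendsto (fun k => φ (κ k) (T (G (κ k)))) atTop (𝓝 0) := by
    have h1 : Tendsto (fun k => C * ‖T (G (κ k)) - y‖) atTop (𝓝 0) := by
      have := (tendsto_iff_norm_sub_tendsto_zero.1 hy).const_mul C
      simpa using this
    refine squeeze_zero_norm (fun k => ?_) h1
    have h2 := (φ (κ k)).le_opNorm (T (G (κ k)) - y)
    rw [map_sub, hφy, sub_zero] at h2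
    exact h2.trans (by gcongr; exact hφC _)
  have hdiag : ∀ k, φ k (T (G k)) = ∫ z in Metric.ball (0 : CSpace n) r, f (v k + z) * l z := by
    intro k
    rw [hφT, setIntegral_ball_eq_translate]
    congr 1
    ext z
    rw [mul_div_cancel_right₀ _ (coherent_ne_zero m (hv0 k) _), add_sub_cancel_left]
  obtain ⟨Q, hQ⟩ := exists_polynomial_polySymbol_line p e
  set P : Polynomial ℂ := ∑ i ∈ Finset.range (Q.natDegree + 1), Polynomial.C
    (∫ z in Metric.ball (0 : CSpace n) r, Q.coeff i (w + z) * l z) * Polynomial.X ^ i with hP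
  have hPt : ∀ t : ℝ, P.eval (t : ℂ) =
      ∫ z in Metric.ball (0 : CSpace n) r, f (w + (t : ℂ) • e + z) * l z := by
    intro t
    have h1 : ∀ z, f (w + (t : ℂ) • e + z) * l z =
        ∑ i ∈ Finset.range (Q.natDegree + 1), (t : ℂ) ^ i * (Q.coeff i (w + z) * l z) := by
      intro z
      rw [add_right_comm, show f = polySymbol p from rfl, hQ, Finset.sum_mul]
      simp only [mul_assoc]
    simp only [h1]
    rw [integral_finsetSum _ fun i _ => Continuous.integrableOn_ball (by fun_prop) _ _]
    simp only [integral_const_mul, hP, Polynomial.eval_finsetSum, Polynomial.eval_mul,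
      Polynomial.eval_C, Polynomial.eval_pow, Polynomial.eval_X]
    simp only [mul_comm]
  have hP0 : P = 0 := by
    refine Polynomial.eq_zero_of_tendsto_zero (s := fun k => ((s (κ k) : ℝ) : ℂ)) ?_ ?_
    · refine tendsto_atTop_mono (fun k => ?_)
        (tendsto_natCast_atTop_atTop.comp hκ.tendsto_atTop : Tendsto (fun k => ((κ k : ℕ) : ℝ)) _ _)
      rw [Complex.norm_real, Real.norm_eq_abs]
      refine le_trans ?_ (le_abs_self _)
      simp only [hs, Function.comp_apply]
      linarith [norm_nonneg w]
    · refine hlim.congr fun k => ?_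
      rw [hdiag, hPt]
  -- The parameter `t = 0` corresponds to the point `w` itself.
  have := hPt 0
  rw [hP0] at this
  simpa using this.symm

end FockSobolev

theorem mainTheorem5 (n m : ℕ) [NeZero n] (p : MvPolynomial (Fin n ⊕ Fin n) ℂ) :
    FockSobolev.HankelCompact n m (FockSobolev.polySymbol p) ↔
      Differentiable ℂ (FockSobolev.polySymbol p : FockSobolev.CSpace n → ℂ) := by
  refine ⟨fun h w => ?_, FockSobolev.hankelCompact_of_differentiable n m⟩
  exact FockSobolev.differentiableAt_complex_of_setIntegral_eq_zero
    (FockSobolev.continuous_polySymbol p) (FockSobolev.differentiable_real_polySymbol p w)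
    fun l r _ hr => FockSobolev.setIntegral_polySymbol_mul_eq_zero n m p h l hr w
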